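/- Let $\Omega\subset\mathbb R^2$ be a bounded domain with polygonal boundary $\Gamma=\partial\Omega$ (with $\Omega=\operatorname{int}\overline\Omega$, i.e. without slits), and let $\mathcal T_0$ be a conforming triangulation of $\Omega$ into nondegenerate closed triangles. Then there are constants $C,C'>0$, depending only on $\Omega$ and $\mathcal T_0$, such that the following holds. Choose a reference edge for every element of $\mathcal T_0$, and let $(\mathcal T_\ell)_{\ell\ge0}$ be any sequence of meshes generated from $\mathcal T_0$ by newest vertex bisection: in step $\ell$ a set of edges of $\mathcal T_\ell$ is halved which contains the reference edge of every element that has an edge in it; each element is split into 1 to 4 sons by iterated bisection of reference edges, and the reference edge of a son is the edge opposite to its newest vertex. Let $\mathcal N_\ell$ be the set of nodes of $\mathcal T_\ell$, $\mathcal E_\ell^\Gamma$ the set of its boundary edges (the edges that are not the intersection of two elements), and $\mathcal S^1(\mathcal T_\ell)$ the space of continuous functions on $\overline\Omega$ that are affine on each element. Let $g:\Gamma\to\mathbb R$ be any function (for instance $g\in H^1(\Gamma)\subset C(\Gamma)$; only its values at boundary nodes matter), and let $g_\ell$ be its nodal interpolant on $\Gamma$ with respect to $\mathcal T_\ell$: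 $g_\ell$ is continuous on $\Gamma$, affine on each $E\in\mathcal E_\ell^\Gamma$, and $g_\ell(z)=g(z)$ for all $z\in\mathcal N_\ell\cap\Gamma$. For all $\ell\ge0$ and all $W_{\ell+1}\in\mathcal S^1(\mathcal T_{\ell+1})$ with $W_{\ell+1}|_\Gamma=g_{\ell+1}$, if $W_{\ell+1}^\ell\in\mathcal S^1(\mathcal T_{\ell+1})$ is defined by $W_{\ell+1}^\ell(z)=W_{\ell+1}(z)$ for $z\in\mathcal N_{\ell+1}\setminus\Gamma$ and $W_{\ell+1}^\ell(z)=g_\ell(z)$ for $z\in\mathcal N_{\ell+1}\cap\Gamma$, then $$\|W_{\ell+1}-W_{\ell+1}^\ell\|_{H^1(\Omega)}\le C\,\|h_\ell^{1/2}(g_{\ell+1}-g_\ell)'\|_{L^2(\Gamma)}\le C'\,\|g_{\ell+1}-g_\ell\|_{H^{1/2}(\Gamma)}.$$ Here $(\cdot)'$ is the arclength derivative, $h_\ell|_E=\operatorname{diam}(E)$ for $E\in\mathcal E_\ell^\Gamma$, and $\|v\|_{H^{1/2}(\Gamma)}^2=\|v\|_{L^2(\Gamma)}^2+\int_\Gamma\int_\Gamma\frac{|v(x)-v(y)|^2}{|x-y|^2}\,d\sigma(y)\,d\sigma(x)$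 with the arclength measure $\sigma$. -/

import Mathlib

open MeasureTheory Set
open scoped NNReal ENNReal ContDiff

namespace AFEM

/-- The Euclidean plane. -/
abbrev Plane : Type := EuclideanSpace ℝ (Fin 2)

/-! ### Domains and Sobolev norms -/

/-- A bounded domain in the plane with polygonal boundary. The condition
`interior (closure Ω) = Ω` says that there are no slits or isolated boundary points. -/
structure IsPolygonalDomain (Ω : Set Plane) : Prop where
  isOpen : IsOpen Ω
  isConnected : IsConnected Ω
  isBounded : Bornology.IsBounded Ω
  interior_closure : interior (closure Ω) = Ω
  polygonal : ∃ S : Finset (Plane × Plane), frontier Ω = ⋃ p ∈ S, segment ℝ p.1 p.2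

/-- `G` is the weak (distributional) gradient of `w` on `Ω`. -/
structure IsWeakGradient (Ω : Set Plane) (w : Plane → ℝ) (G : Plane → Plane) : Prop where
  locallyIntegrableOn : LocallyIntegrableOn w Ω volume
  locallyIntegrableOn_grad : LocallyIntegrableOn G Ω volume
  integral_eq : ∀ φ : Plane → ℝ, ContDiff ℝ ∞ φ → HasCompactSupport φ → tsupport φ ⊆ Ω →
    ∀ e : Plane, ∫ x in Ω, w x * fderiv ℝ φ x e = - ∫ x in Ω, inner ℝ (G x) e * φ x

/-- The norm of `H¹(Ω)`, i.e. `(‖w‖² + ‖∇w‖²)^(1/2)` with `L²(Ω)`-norms and the weak gradient.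
Weak gradients are unique almost everywhere, so the infimum only picks the gradient; the value
is `∞` if there is none. -/
noncomputable def h1Norm (Ω : Set Plane) (w : Plane → ℝ) : ℝ≥0∞ :=
  ⨅ (G : Plane → Plane) (_ : IsWeakGradient Ω w G),
    (eLpNorm w 2 (volume.restrict Ω) ^ 2 + eLpNorm G 2 (volume.restrict Ω) ^ 2) ^ (1 / 2 : ℝ)

/-- The arclength measure on a set `Γ`: one-dimensional Hausdorff measure restricted to `Γ`. -/
noncomputable def arclength (Γ : Set Plane) : Measure Plane :=
  (Measure.hausdorffMeasure 1).restrict Γ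

/-- The Sobolev-Slobodeckij norm of `H^{1/2}(Γ)` on a curve `Γ`. -/
noncomputable def hHalfNorm (Γ : Set Plane) (v : Plane → ℝ) : ℝ≥0∞ :=
  (eLpNorm v 2 (arclength Γ) ^ 2 +
    ∫⁻ x, ∫⁻ y, edist (v x) (v y) ^ 2 / edist x y ^ 2 ∂(arclength Γ) ∂(arclength Γ)) ^ (1 / 2 : ℝ)

/-! ### Triangulations. A triangle is given by the set of its three vertices, an edge by the set
of its two endpoints. -/

/-- `T` is a conforming triangulation of `Ω` (regular in the sense of Ciarlet): nondegenerate
triangles which cover the closure of `Ω`, any two of which meet in a common face (or not at all). -/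
structure IsTriangulation (Ω : Set Plane) (T : Finset (Finset Plane)) : Prop where
  card_eq : ∀ t ∈ T, t.card = 3
  affineIndependent : ∀ t ∈ T, AffineIndependent ℝ ((↑) : t → Plane)
  iUnion_eq : ⋃ t ∈ T, convexHull ℝ (t : Set Plane) = closure Ω
  inter_eq : ∀ s ∈ T, ∀ t ∈ T, convexHull ℝ (s : Set Plane) ∩ convexHull ℝ (t : Set Plane) =
    convexHull ℝ ((s : Set Plane) ∩ (t : Set Plane))

open Classical in
/-- The set of nodes. -/
noncomputable def nodes (T : Finset (Finset Plane)) : Finset Plane :=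
  T.biUnion fun t => t

open Classical in
/-- The set of edges. -/
noncomputable def edges (T : Finset (Finset Plane)) : Finset (Finset Plane) :=
  T.biUnion fun t => t.powersetCard 2

open Classical in
/-- The set of boundary edges: those edges which are not the intersection of two elements. -/
noncomputable def boundaryEdges (T : Finset (Finset Plane)) : Finset (Finset Plane) :=
  (edges T).filter fun E => ¬ ∃ s ∈ T, ∃ t ∈ T, s ∩ t = E

/-- `v` is affine on the convex hull of the point set `t` (a triangle or an edge). -/
def IsAffineOn (v : Plane → ℝ) (t : Finset Plane) : Prop :=
  ∃ A : Plane →ᵃ[ℝ] ℝ, EqOn v A (convexHull ℝ (t : Set Plane))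

/-- The P1 finite element space `S¹(T)`: continuous on the closure of `Ω`, affine on every
triangle. (Values outside the closure of `Ω` are irrelevant.) -/
def IsP1 (Ω : Set Plane) (T : Finset (Finset Plane)) (V : Plane → ℝ) : Prop :=
  ContinuousOn V (closure Ω) ∧ ∀ t ∈ T, IsAffineOn V t

/-- `v` is the nodal interpolant of `g` in `S¹(T|_Γ)`, `Γ = ∂Ω`: it is continuous on `Γ`, affine
on every boundary edge, and coincides with `g` in all boundary nodes. (Values outside of `Γ`
are irrelevant.) -/
structure IsNodalInterpolant (Ω : Set Plane) (T : Finset (Finset Plane)) (g v : Plane → ℝ) :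
    Prop where
  continuousOn : ContinuousOn v (frontier Ω)
  isAffineOn : ∀ E ∈ boundaryEdges T, IsAffineOn v E
  eq_node : ∀ z ∈ nodes T, z ∈ frontier Ω → v z = g z

open Classical in
/-- A unit tangent vector of the edge `E` (its sign plays no role below). -/
noncomputable def unitTangent (E : Finset Plane) : Plane :=
  if h : ∃ τ ∈ vectorSpan ℝ (E : Set Plane), ‖τ‖ = 1 then h.choose else 0

/-- The arclength derivative of `v` along the edge `E`. It only uses the values of `v` on `E`
if `x` is a relative interior point of `E`. -/
noncomputable def arcDeriv (E : Finset Plane) (v : Plane → ℝ) (x : Plane) : ℝ :=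
  lineDeriv ℝ v x (unitTangent E)

/-- `‖h^{1/2} v'‖_{L²(Γ)}`, where `v'` is the arclength derivative and `h` the local mesh-width,
`h|_E = h_E = diam E` for all boundary edges `E` of `T`; the boundary edges partition `Γ`. -/
noncomputable def weightedArcDerivNorm (T : Finset (Finset Plane)) (v : Plane → ℝ) : ℝ≥0∞ :=
  (∑ E ∈ boundaryEdges T, ENNReal.ofReal (Metric.diam (convexHull ℝ (E : Set Plane))) *
    eLpNorm (arcDeriv E v) 2 (arclength (convexHull ℝ (E : Set Plane))) ^ 2) ^ (1 / 2 : ℝ)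

/-! ### Newest vertex bisection -/

/-- A triangle `K.1` together with its reference edge `K.2`. -/
abbrev MarkedTriangle : Type := Finset Plane × Finset Plane

/-- A mesh with a reference edge for each element. -/
abbrev MarkedMesh : Type := Finset MarkedTriangle

open Classical in
/-- The triangulation underlying a mesh with reference edges. -/
noncomputable def elements (M : MarkedMesh) : Finset (Finset Plane) :=
  M.image Prod.fst

/-- The midpoint of an edge. -/
noncomputable def edgeMidpoint (E : Finset Plane) : Plane :=
  (1 / 2 : ℝ) • ∑ x ∈ E, x

open Classical in
/-- The two sons obtained by bisecting the reference edge of `K` in its midpoint `m`. For each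
endpoint `p` of the reference edge there is the son in which `p` is replaced by `m`; its reference
edge is the edge opposite to the newest vertex `m`. -/
noncomputable def bisect (K : MarkedTriangle) : Finset MarkedTriangle :=
  K.2.image fun p => (insert (edgeMidpoint K.2) (K.1.erase p), K.1.erase p)

open Classical in
/-- Refinement of one element by iterated bisection, where `F` is the set of edges to be halved:
1, 2, 3 or 4 sons, if no edge, only the reference edge, one further edge or all edges are in `F`. -/
noncomputable def refineElement (F : Finset (Finset Plane)) (K : MarkedTriangle) :
    Finset MarkedTriangle :=
  if K.2 ∈ F then (bisect K).biUnion fun K' => if K'.2 ∈ F then bisect K' else {K'} else {K}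

open Classical in
/-- `M'` is obtained from `M` by one step of newest vertex bisection. Here `F` is the set of all
edges which are halved, i.e. the marked edges and those added to avoid hanging nodes: whenever an
edge of an element is halved, so is the reference edge of this element. -/
def IsNVBStep (M M' : MarkedMesh) : Prop :=
  ∃ F ⊆ edges (elements M), (∀ K ∈ M, ∀ E ∈ F, E ⊆ K.1 → K.2 ∈ F) ∧
    M' = M.biUnion (refineElement F)

open Classical in
/-- `M` is a sequence of meshes generated by newest vertex bisection from the initial
triangulation `T₀` with some choice of one reference edge per element. -/
def IsNVBSequence (T₀ : Finset (Finset Plane)) (M : ℕ → MarkedMesh) : Prop :=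
  (∃ ref : Finset Plane → Finset Plane, (∀ t ∈ T₀, ref t ∈ t.powersetCard 2) ∧
    M 0 = T₀.image fun t => (t, ref t)) ∧
  ∀ l, IsNVBStep (M l) (M (l + 1))

end AFEM

namespace AFEM

/-! ### Barycentric weights -/

/-! The difference D = W - W' vanishes at every interior node and at every old boundary node, where
both interpolants equal g. Its only possibly nonzero nodal values sit at boundary nodes created in
this step. Such a node is the midpoint of a boundary edge E of the old mesh, and the value there is
δ_E, the value of g₁ - g₀ at that midpoint. All three norms are compared with S = ∑ δ_E².

In the plane |∇D|² |K| is bounded by the squared nodal values on K with a constant depending only on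
the shape of K, so the squared H¹ norm is at most a constant times S
(`IsShapeRegular.gradient_estimate`, `IsMarkedTriangulation.sum_nodal_le`). On E the function g₁ -
g₀ is a hat of height δ_E with slopes ±2δ_E/h_E, so the squared weighted norm is exactly 4S
(`diam_mul_eLpNorm_arcDeriv`). On half of E it is affine with constant difference quotient, and the
double integral over this half is δ_E²; disjoint halves bound S by the squared H^{1/2} norm
(`le_lintegral_openSegment`).

The rest is geometry, uniform over all meshes. Conformity is encoded by barycentric weights extended
by zero: the weight function of a point is the same for all elements containing it. Halving an edge
changes weights by a rule that does not mention the element (`bisectWeight`), so conformity is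
inherited (`IsMarkedTriangulation.step`). The shape constant σ is inherited exactly
(`norm_sq_bisect`). Finally, since Ω is the interior of its closure, the midpoint of an edge shared
by two elements lies in Ω (`IsMarkedTriangulation.midpoint_mem`); hence new nodes on Γ come only
from boundary edges. -/

/-- The planar cross product. -/
def cross (u v : Plane) : ℝ := u 0 * v 1 - u 1 * v 0

theorem norm_sq_plane (u : Plane) : ‖u‖ ^ 2 = u 0 ^ 2 + u 1 ^ 2 := by
  rw [EuclideanSpace.norm_sq_eq, Fin.sum_univ_two]; simp

theorem plane_ext {u v : Plane} (h0 : u 0 = v 0) (h1 : u 1 = v 1) : u = v := by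
  ext i; fin_cases i <;> assumption

/-- `w` are barycentric weights of `x` with respect to the point set `s`, extended by zero. -/
structure IsWeight (s : Finset Plane) (x : Plane) (w : Plane → ℝ) : Prop where
  nonneg : ∀ z, 0 ≤ w z
  eq_zero : ∀ z, z ∉ s → w z = 0
  sum_eq_one : ∑ z ∈ s, w z = 1
  sum_smul : ∑ z ∈ s, w z • z = x

theorem mem_convexHull_iff_exists_isWeight {s : Finset Plane} {x : Plane} :
    x ∈ convexHull ℝ (s : Set Plane) ↔ ∃ w, IsWeight s x w := by
  classical
  rw [Finset.mem_convexHull']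
  constructor
  · rintro ⟨w, h0, h1, h2⟩
    refine ⟨fun z => if z ∈ s then w z else 0, ⟨fun z => ?_, fun z hz => ?_, ?_, ?_⟩⟩
    · split_ifs with hz
      exacts [h0 z hz, le_rfl]
    · simp [hz]
    · rw [← h1]
      exact Finset.sum_congr rfl fun z hz => by simp [hz]
    · rw [← h2]
      exact Finset.sum_congr rfl fun z hz => by simp [hz]
  · rintro ⟨w, h⟩
    exact ⟨w, fun y _ => h.nonneg y, h.sum_eq_one, h.sum_smul⟩

theorem IsWeight.mono {s t : Finset Plane} {x : Plane} {w : Plane → ℝ} (h : IsWeight s x w)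
    (hst : s ⊆ t) : IsWeight t x w where
  nonneg := h.nonneg
  eq_zero z hz := h.eq_zero z fun hs => hz (hst hs)
  sum_eq_one := by
    rw [← h.sum_eq_one]
    exact (Finset.sum_subset hst fun z _ hz => h.eq_zero z hz).symm
  sum_smul := by
    rw [← h.sum_smul]
    exact (Finset.sum_subset hst fun z _ hz => by simp [h.eq_zero z hz]).symm

theorem cross_ne_zero_distinct {p q c : Plane} (h : cross (p - c) (q - c) ≠ 0) :
    p ≠ q ∧ p ≠ c ∧ q ≠ c := by
  refine ⟨?_, ?_, ?_⟩ <;> rintro rfl <;> apply h <;> (simp [cross]; try ring)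

/-! ### Weights on one triangle and their change under bisection. -/

section Triangle

variable {p q c : Plane}

open Classical in
theorem sum_triple {β : Type*} [AddCommMonoid β] (h : cross (p - c) (q - c) ≠ 0) (f : Plane → β) :
    ∑ z ∈ ({p, q, c} : Finset Plane), f z = f p + f q + f c := by
  obtain ⟨h1, h2, h3⟩ := cross_ne_zero_distinct h
  rw [Finset.sum_insert (by simp [h1, h2]), Finset.sum_pair h3, add_assoc]

open Classical in
theorem isWeight_triple_iff (h : cross (p - c) (q - c) ≠ 0) {x : Plane} {w : Plane → ℝ} :
    IsWeight {p, q, c} x w ↔ (∀ z, 0 ≤ w z) ∧ (∀ z, z ≠ p → z ≠ q → z ≠ c → w z = 0) ∧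
      w p + w q + w c = 1 ∧ w p • p + w q • q + w c • c = x := by
  constructor
  · intro hw
    refine ⟨hw.nonneg, fun z h1 h2 h3 => hw.eq_zero z (by simp [h1, h2, h3]), ?_, ?_⟩
    · rw [← hw.sum_eq_one, sum_triple h]
    · rw [← hw.sum_smul, sum_triple h]
  · rintro ⟨h0, h1, h2, h3⟩
    refine ⟨h0, fun z hz => ?_, ?_, ?_⟩
    · simp only [Finset.mem_insert, Finset.mem_singleton, not_or] at hz
      exact h1 z hz.1 hz.2.1 hz.2.2
    · rw [sum_triple h, h2]
    · rw [sum_triple h, h3]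

-- Eliminating the weight of `c` leaves a 2×2 system with determinant `cross (p - c) (q - c)`,
-- solved by Cramer's rule. Equality holds as functions on the plane, which makes weights of
-- different triangles comparable.
open Classical in
theorem IsWeight.unique (h : cross (p - c) (q - c) ≠ 0) {x : Plane} {w w' : Plane → ℝ}
    (hw : IsWeight {p, q, c} x w) (hw' : IsWeight {p, q, c} x w') : w = w' := by
  rw [isWeight_triple_iff h] at hw hw'
  obtain ⟨-, h1, h2, h3⟩ := hw
  obtain ⟨-, h1', h2', h3'⟩ := hw'
  rw [← h3'] at h3
  have e0 := congrArg (fun v : Plane => v 0) h3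
  have e1 := congrArg (fun v : Plane => v 1) h3
  simp only [PiLp.add_apply, PiLp.smul_apply, smul_eq_mul] at e0 e1
  have hc : w c = 1 - w p - w q := by linarith
  have hc' : w' c = 1 - w' p - w' q := by linarith
  rw [hc, hc'] at e0 e1
  have hp : w p = w' p := by
    apply mul_right_cancel₀ h
    simp only [cross, PiLp.sub_apply]
    linear_combination (q 1 - c 1) * e0 - (q 0 - c 0) * e1
  have hq : w q = w' q := by
    apply mul_right_cancel₀ h
    simp only [cross, PiLp.sub_apply]
    linear_combination (p 0 - c 0) * e1 - (p 1 - c 1) * e0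
  funext z
  by_cases z1 : z = p
  · rw [z1, hp]
  by_cases z2 : z = q
  · rw [z2, hq]
  by_cases z3 : z = c
  · rw [z3, hc, hc', hp, hq]
  rw [h1 z z1 z2 z3, h1' z z1 z2 z3]

open Classical in
/-- The function with values `α, β, γ` at `p, q, c` and zero elsewhere. -/
noncomputable def tripleWeight (p q c : Plane) (α β γ : ℝ) (z : Plane) : ℝ :=
  if z = p then α else if z = q then β else if z = c then γ else 0

theorem tripleWeight_values (h : cross (p - c) (q - c) ≠ 0) (α β γ : ℝ) :
    tripleWeight p q c α β γ p = α ∧ tripleWeight p q c α β γ q = β ∧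
      tripleWeight p q c α β γ c = γ := by
  obtain ⟨h1, h2, h3⟩ := cross_ne_zero_distinct h
  simp [tripleWeight, h1.symm, h2.symm, h3.symm]

open Classical in
theorem isWeight_tripleWeight (h : cross (p - c) (q - c) ≠ 0) {α β γ : ℝ} (hα : 0 ≤ α) (hβ : 0 ≤ β)
    (hγ : 0 ≤ γ) (hs : α + β + γ = 1) :
    IsWeight {p, q, c} (α • p + β • q + γ • c) (tripleWeight p q c α β γ) := by
  obtain ⟨h1, h2, h3⟩ := tripleWeight_values h α β γ
  rw [isWeight_triple_iff h, h1, h2, h3]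
  refine ⟨fun z => ?_, fun z z1 z2 z3 => by simp [tripleWeight, z1, z2, z3], hs, rfl⟩
  unfold tripleWeight
  split_ifs <;> first | assumption | exact le_rfl

open Classical in
theorem edgeMidpoint_pair (h : p ≠ q) : edgeMidpoint {p, q} = (1 / 2 : ℝ) • (p + q) := by
  rw [edgeMidpoint, Finset.sum_pair h]

/-- The smallest weight on the edge `e`. -/
noncomputable def minWeight (e : Finset Plane) (w : Plane → ℝ) : ℝ := sInf (w '' (e : Set Plane))

open Classical in
/-- The change of barycentric weights if the edge `e` is halved. -/
noncomputable def bisectWeight (e : Finset Plane) (w : Plane → ℝ) (z : Plane) : ℝ :=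
  w z - (if z ∈ e then minWeight e w else 0) +
    if z = edgeMidpoint e then 2 * minWeight e w else 0

open Classical in
theorem minWeight_pair (w : Plane → ℝ) : minWeight {p, q} w = min (w p) (w q) := by
  simp only [minWeight, Finset.coe_insert, Finset.coe_singleton, image_pair]
  exact csInf_pair _ _

theorem bisectWeight_of_minWeight_eq_zero {e : Finset Plane} {w : Plane → ℝ}
    (h : minWeight e w = 0) : bisectWeight e w = w := by
  funext z; simp [bisectWeight, h]

theorem minWeight_eq_zero {e : Finset Plane} {w : Plane → ℝ} (h0 : ∀ z, 0 ≤ w z) {z : Plane}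
    (hz : z ∈ e) (h : w z = 0) : minWeight e w = 0 := by
  apply IsLeast.csInf_eq
  refine ⟨⟨z, hz, h⟩, ?_⟩
  rintro _ ⟨y, -, rfl⟩
  exact h0 y

theorem cross_bisect :
    cross (q - (1 / 2 : ℝ) • (p + q)) (c - (1 / 2 : ℝ) • (p + q)) =
      cross (p - c) (q - c) / 2 := by
  simp only [cross, PiLp.sub_apply, PiLp.add_apply, PiLp.smul_apply, smul_eq_mul]
  ring

/-- This is the parallelogram law. With `cross_bisect`, both sides of the inequality in
`IsShapeRegular` are halved by a bisection, so the same σ serves on all levels. -/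
theorem norm_sq_bisect :
    ‖q - (1 / 2 : ℝ) • (p + q)‖ ^ 2 + ‖c - (1 / 2 : ℝ) • (p + q)‖ ^ 2 =
      (‖p - c‖ ^ 2 + ‖q - c‖ ^ 2) / 2 := by
  simp only [norm_sq_plane, PiLp.sub_apply, PiLp.add_apply, PiLp.smul_apply, smul_eq_mul]
  ring

theorem midpoint_ne (h : cross (p - c) (q - c) ≠ 0) : (1 / 2 : ℝ) • (p + q) ≠ p ∧
    (1 / 2 : ℝ) • (p + q) ≠ q ∧ (1 / 2 : ℝ) • (p + q) ≠ c := by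
  obtain ⟨h1, h2, h3⟩ := cross_ne_zero_distinct h
  have hd : cross (q - (1 / 2 : ℝ) • (p + q)) (c - (1 / 2 : ℝ) • (p + q)) ≠ 0 := by
    rw [cross_bisect]; exact div_ne_zero h two_ne_zero
  obtain ⟨-, h5, h6⟩ := cross_ne_zero_distinct hd
  refine ⟨fun h0 => h1 ?_, h5.symm, h6.symm⟩
  have : (2 : ℝ) • ((1 / 2 : ℝ) • (p + q)) = (2 : ℝ) • p := by rw [h0]
  rw [smul_smul, two_smul] at this
  norm_num at this
  exact this.symm

-- With m the midpoint, w_p p + w_q q = (w_q - w_p) q + 2 w_p m; the order of the two weights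
-- decides which son contains the point.
open Classical in
theorem IsWeight.bisectWeight (h : cross (p - c) (q - c) ≠ 0) {x : Plane} {w : Plane → ℝ}
    (hw : IsWeight {p, q, c} x w) (hpq : w p ≤ w q) :
    IsWeight {q, c, (1 / 2 : ℝ) • (p + q)} x (bisectWeight {p, q} w) := by
  obtain ⟨h1, h2, h3⟩ := cross_ne_zero_distinct h
  obtain ⟨m1, m2, m3⟩ := midpoint_ne h
  have hd : cross (q - (1 / 2 : ℝ) • (p + q)) (c - (1 / 2 : ℝ) • (p + q)) ≠ 0 := by
    rw [cross_bisect]; exact div_ne_zero h two_ne_zero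
  rw [isWeight_triple_iff h] at hw
  obtain ⟨w0, w1, w2, w3⟩ := hw
  have hmin : minWeight {p, q} w = w p := by rw [minWeight_pair, min_eq_left hpq]
  have hm0 : w ((1 / 2 : ℝ) • (p + q)) = 0 := w1 _ m1 m2 m3
  have vp : AFEM.bisectWeight {p, q} w p = 0 := by
    simp [AFEM.bisectWeight, edgeMidpoint_pair h1, hmin, -one_div, -smul_add, m1.symm]
  have vq : AFEM.bisectWeight {p, q} w q = w q - w p := by
    simp [AFEM.bisectWeight, edgeMidpoint_pair h1, hmin, -one_div, -smul_add, m2.symm]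
  have vc : AFEM.bisectWeight {p, q} w c = w c := by
    simp [AFEM.bisectWeight, edgeMidpoint_pair h1, -one_div, -smul_add, m3.symm, h2.symm, h3.symm]
  have vm : AFEM.bisectWeight {p, q} w ((1 / 2 : ℝ) • (p + q)) = 2 * w p := by
    simp [AFEM.bisectWeight, edgeMidpoint_pair h1, hmin, -one_div, -smul_add, m1, m2, hm0]
  have vo : ∀ z, z ≠ q → z ≠ c → z ≠ (1 / 2 : ℝ) • (p + q) → AFEM.bisectWeight {p, q} w z = 0 := by
    intro z z1 z2 z3
    by_cases zp : z = p
    · rw [zp, vp]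
    · simp [AFEM.bisectWeight, edgeMidpoint_pair h1, -one_div, -smul_add, z1, z3, zp,
        w1 z zp z1 z2]
  rw [isWeight_triple_iff hd]
  refine ⟨fun z => ?_, vo, ?_, ?_⟩
  · by_cases z1 : z = q
    · rw [z1, vq]; linarith
    by_cases z2 : z = c
    · rw [z2, vc]; exact w0 c
    by_cases z3 : z = (1 / 2 : ℝ) • (p + q)
    · rw [z3, vm]; linarith [w0 p]
    rw [vo z z1 z2 z3]
  · rw [vq, vc, vm]; linarith
  · rw [vq, vc, vm, ← w3]
    module

open Classical in
theorem IsWeight.exists_of_bisect (h : cross (p - c) (q - c) ≠ 0) {x : Plane} {w' : Plane → ℝ}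
    (hw : IsWeight {q, c, (1 / 2 : ℝ) • (p + q)} x w') :
    ∃ w, IsWeight {p, q, c} x w ∧ w' = AFEM.bisectWeight {p, q} w ∧ w p ≤ w q ∧
      ((∀ z ∈ ({q, c, (1 / 2 : ℝ) • (p + q)} : Finset Plane), 0 < w' z) →
        (∀ z ∈ ({p, q, c} : Finset Plane), 0 < w z) ∧ w p < w q) := by
  obtain ⟨h1, h2, h3⟩ := cross_ne_zero_distinct h
  have hd : cross (q - (1 / 2 : ℝ) • (p + q)) (c - (1 / 2 : ℝ) • (p + q)) ≠ 0 := by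
    rw [cross_bisect]; exact div_ne_zero h two_ne_zero
  have hw2 := hw
  rw [isWeight_triple_iff hd] at hw
  obtain ⟨w0, w1, w2, w3⟩ := hw
  set m := (1 / 2 : ℝ) • (p + q) with hm
  -- Since m = (p + q)/2, its weight is shared equally between p and q.
  have H := isWeight_tripleWeight h (α := w' m / 2) (β := w' q + w' m / 2) (γ := w' c)
    (by linarith [w0 m]) (by linarith [w0 m, w0 q]) (w0 c) (by linarith)
  have hx : (w' m / 2) • p + (w' q + w' m / 2) • q + w' c • c = x := by
    rw [← w3, hm]; module
  rw [hx] at H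
  obtain ⟨v1, v2, v3⟩ := tripleWeight_values h (w' m / 2) (w' q + w' m / 2) (w' c)
  have hle : tripleWeight p q c (w' m / 2) (w' q + w' m / 2) (w' c) p ≤
      tripleWeight p q c (w' m / 2) (w' q + w' m / 2) (w' c) q := by
    rw [v1, v2]; linarith [w0 q]
  refine ⟨_, H, hw2.unique hd (H.bisectWeight h hle), hle, fun hpos => ?_⟩
  have p1 := hpos q (by simp)
  have p2 := hpos c (by simp)
  have p3 := hpos m (by simp)
  refine ⟨fun z hz => ?_, by rw [v1, v2]; linarith⟩
  simp only [Finset.mem_insert, Finset.mem_singleton] at hz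
  rcases hz with rfl | rfl | rfl
  · rw [v1]; linarith
  · rw [v2]; linarith
  · rw [v3]; linarith

end Triangle

/-! ### Newest vertex bisection preserves conformity and shape regularity -/

open Classical in
/-- `K` is a nondegenerate triangle, and the sum of the squared lengths of the two edges which are
not the reference edge is bounded by `σ` times twice the area. -/
def IsShapeRegular (σ : ℝ) (K : MarkedTriangle) : Prop :=
  ∃ p q c : Plane, K = ({p, q, c}, {p, q}) ∧ cross (p - c) (q - c) ≠ 0 ∧
    ‖p - c‖ ^ 2 + ‖q - c‖ ^ 2 ≤ σ * |cross (p - c) (q - c)|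

theorem cross_swap (u v : Plane) : cross u v = -cross v u := by
  simp only [cross]; ring

-- The conditions are symmetric in the endpoints of the reference edge, so `p` may be taken as the
-- endpoint replaced by the midpoint. Later arguments then treat only one form of son.
open Classical in
theorem exists_of_mem_bisect {σ : ℝ} {K K' : MarkedTriangle} (hK : IsShapeRegular σ K)
    (hK' : K' ∈ bisect K) : ∃ p q c : Plane, K = ({p, q, c}, {p, q}) ∧
      cross (p - c) (q - c) ≠ 0 ∧ ‖p - c‖ ^ 2 + ‖q - c‖ ^ 2 ≤ σ * |cross (p - c) (q - c)| ∧
      K' = ({q, c, (1 / 2 : ℝ) • (p + q)}, {q, c}) := by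
  obtain ⟨p, q, c, rfl, h, hσ⟩ := hK
  obtain ⟨h1, h2, h3⟩ := cross_ne_zero_distinct h
  simp only [bisect, Finset.mem_image, Finset.mem_insert, Finset.mem_singleton,
    edgeMidpoint_pair h1] at hK'
  obtain ⟨r, rfl | rfl, rfl⟩ := hK'
  · refine ⟨r, q, c, rfl, h, hσ, ?_⟩
    have : ({r, q, c} : Finset Plane).erase r = {q, c} :=
      Finset.erase_insert (by simp [h1, h2])
    rw [this, Finset.insert_comm, Finset.pair_comm _ c]
  · have hs : ({p, r, c} : Finset Plane) = {r, p, c} := Finset.insert_comm _ _ _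
    refine ⟨r, p, c, ?_, ?_, ?_, ?_⟩
    · rw [hs, Finset.pair_comm p r]
    · rw [cross_swap]; exact neg_ne_zero.2 h
    · rw [cross_swap, abs_neg]; linarith
    · have : ({r, p, c} : Finset Plane).erase r = {p, c} :=
        Finset.erase_insert (by simp [h1.symm, h3])
      rw [hs, this, add_comm p r, Finset.insert_comm, Finset.pair_comm _ c]

open Classical in
theorem son_mem_bisect {p q c : Plane} (h : cross (p - c) (q - c) ≠ 0) :
    (({q, c, (1 / 2 : ℝ) • (p + q)}, {q, c}) : MarkedTriangle) ∈ bisect ({p, q, c}, {p, q}) := by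
  obtain ⟨h1, h2, h3⟩ := cross_ne_zero_distinct h
  simp only [bisect, Finset.mem_image, edgeMidpoint_pair h1]
  refine ⟨p, by simp, ?_⟩
  have : ({p, q, c} : Finset Plane).erase p = {q, c} := Finset.erase_insert (by simp [h1, h2])
  rw [this, Finset.insert_comm, Finset.pair_comm _ c]

theorem IsShapeRegular.card_eq {σ : ℝ} {K : MarkedTriangle} (hK : IsShapeRegular σ K) :
    K.1.card = 3 := by
  classical
  obtain ⟨p, q, c, rfl, h, -⟩ := hK
  obtain ⟨h1, h2, h3⟩ := cross_ne_zero_distinct h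
  exact Finset.card_eq_three.2 ⟨p, q, c, h1, h2, h3, by congr!⟩

theorem IsShapeRegular.ref_subset {σ : ℝ} {K : MarkedTriangle} (hK : IsShapeRegular σ K) :
    K.2 ⊆ K.1 := by
  classical
  obtain ⟨p, q, c, rfl, h, -⟩ := hK
  intro z
  simp only [Finset.mem_insert, Finset.mem_singleton]
  tauto

theorem IsShapeRegular.ref_card {σ : ℝ} {K : MarkedTriangle} (hK : IsShapeRegular σ K) :
    K.2.card = 2 := by
  classical
  obtain ⟨p, q, c, rfl, h, -⟩ := hK
  exact Finset.card_pair (cross_ne_zero_distinct h).1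

theorem IsShapeRegular.weight_unique {σ : ℝ} {K : MarkedTriangle} (hK : IsShapeRegular σ K)
    {x : Plane} {w w' : Plane → ℝ} (hw : IsWeight K.1 x w) (hw' : IsWeight K.1 x w') : w = w' := by
  obtain ⟨p, q, c, rfl, h, -⟩ := hK
  exact hw.unique h hw'

theorem IsShapeRegular.bisect {σ : ℝ} {K K' : MarkedTriangle} (hK : IsShapeRegular σ K)
    (hK' : K' ∈ bisect K) : IsShapeRegular σ K' := by
  obtain ⟨p, q, c, rfl, h, hσ, rfl⟩ := exists_of_mem_bisect hK hK'
  refine ⟨q, c, (1 / 2 : ℝ) • (p + q), rfl, ?_, ?_⟩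
  · rw [cross_bisect]; exact div_ne_zero h two_ne_zero
  · rw [cross_bisect, norm_sq_bisect, abs_div, abs_two]; linarith

open Classical in
/-- The element `K`, bisected if its reference edge belongs to `F`. -/
noncomputable def bisectIf (F : Finset (Finset Plane)) (K : MarkedTriangle) :
    Finset MarkedTriangle :=
  if K.2 ∈ F then bisect K else {K}

open Classical in
/-- The change of barycentric weights if the edge `e` is halved when it belongs to `F`. -/
noncomputable def bisectWeightIf (F : Finset (Finset Plane)) (e : Finset Plane) (w : Plane → ℝ) :
    Plane → ℝ :=
  if e ∈ F then bisectWeight e w else w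

theorem mem_refineElement {F : Finset (Finset Plane)} {K K'' : MarkedTriangle} :
    K'' ∈ refineElement F K ↔ ∃ K' ∈ bisectIf F K, K'' ∈ bisectIf F K' := by
  classical
  unfold refineElement bisectIf
  by_cases h : K.2 ∈ F
  · simp [h]
  · simp [h]

theorem card_bisectIf_le {σ : ℝ} {F : Finset (Finset Plane)} {K : MarkedTriangle}
    (hK : IsShapeRegular σ K) : (bisectIf F K).card ≤ 2 := by
  unfold bisectIf
  split_ifs
  · exact Finset.card_image_le.trans hK.ref_card.le
  · simp

theorem IsShapeRegular.bisectIf {σ : ℝ} {F : Finset (Finset Plane)} {K K' : MarkedTriangle}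
    (hK : IsShapeRegular σ K) (hK' : K' ∈ bisectIf F K) : IsShapeRegular σ K' := by
  unfold AFEM.bisectIf at hK'
  split_ifs at hK'
  · exact hK.bisect hK'
  · rw [Finset.mem_singleton.1 hK']; exact hK

theorem card_refineElement_le {σ : ℝ} {F : Finset (Finset Plane)} {K : MarkedTriangle}
    (hK : IsShapeRegular σ K) : (refineElement F K).card ≤ 4 := by
  classical
  have : refineElement F K = (bisectIf F K).biUnion (bisectIf F) := by
    ext K''; simp [mem_refineElement]
  rw [this]
  refine (Finset.card_biUnion_le_card_mul _ _ 2
    fun K' hK' => card_bisectIf_le (hK.bisectIf hK')).trans ?_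
  have := card_bisectIf_le (F := F) hK
  omega

theorem bisectIf_exists_mem {σ : ℝ} {F : Finset (Finset Plane)} {K : MarkedTriangle}
    (hK : IsShapeRegular σ K) {x : Plane} {w : Plane → ℝ} (hw : IsWeight K.1 x w) :
    ∃ K' ∈ bisectIf F K, ∃ w', IsWeight K'.1 x w' := by
  classical
  unfold bisectIf
  split_ifs with hF
  · obtain ⟨p, q, c, rfl, h, hσ⟩ := hK
    obtain hle | hle := le_total (w p) (w q)
    · exact ⟨_, son_mem_bisect h, _, hw.bisectWeight h hle⟩
    · have h' : cross (q - c) (p - c) ≠ 0 := by rw [cross_swap]; exact neg_ne_zero.2 h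
      have hs : ({p, q, c} : Finset Plane) = {q, p, c} := Finset.insert_comm _ _ _
      rw [hs, Finset.pair_comm p q]
      refine ⟨_, son_mem_bisect h', _, IsWeight.bisectWeight h' (w := w) (hs ▸ hw) hle⟩
  · exact ⟨K, by simp, w, hw⟩

/-- The weights in a son are a function of the weights in the father that does not name the son. The
last clause says that the sons have disjoint interiors. -/
theorem exists_weight_of_mem_bisectIf {σ : ℝ} {F : Finset (Finset Plane)} {K K' : MarkedTriangle}
    (hK : IsShapeRegular σ K) (hK' : K' ∈ bisectIf F K) {x : Plane} {w' : Plane → ℝ}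
    (hw' : IsWeight K'.1 x w') :
    ∃ w, IsWeight K.1 x w ∧ w' = bisectWeightIf F K.2 w ∧ ((∀ z ∈ K'.1, 0 < w' z) →
      (∀ z ∈ K.1, 0 < w z) ∧ ∀ L' ∈ bisectIf F K, IsWeight L'.1 x w' → L' = K') := by
  classical
  unfold bisectIf at *
  unfold bisectWeightIf
  split_ifs at hK' ⊢ with hF
  · have hKK := hK
    obtain ⟨p, q, c, rfl, h, hσ, rfl⟩ := exists_of_mem_bisect hK hK'
    obtain ⟨w, h1, h2, h3, h4⟩ := IsWeight.exists_of_bisect h hw'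
    refine ⟨w, h1, h2, fun hpos => ⟨(h4 hpos).1, fun L' hL' hwL => ?_⟩⟩
    obtain ⟨d1, d2, d3⟩ := cross_ne_zero_distinct h
    have hlt := (h4 hpos).2
    simp only [bisect, Finset.mem_image, Finset.mem_insert, Finset.mem_singleton,
      edgeMidpoint_pair d1] at hL'
    obtain ⟨r, rfl | rfl, rfl⟩ := hL'
    · have : ({r, q, c} : Finset Plane).erase r = {q, c} :=
        Finset.erase_insert (by simp [d1, d2])
      rw [this, Finset.insert_comm, Finset.pair_comm _ c]
    -- The other son lacks the vertex `r`, so the weight would vanish there.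
    · exfalso
      have hqp : (1 / 2 : ℝ) • (p + r) ≠ r := (midpoint_ne h).2.1
      have : w' r = 0 := hwL.eq_zero r (by simp [hqp.symm, -one_div, -smul_add])
      have := hpos r (by simp)
      linarith
  · rw [Finset.mem_singleton] at hK'
    subst hK'
    exact ⟨w', hw', rfl, fun hpos => ⟨hpos, fun L' hL' _ => by simpa using hL'⟩⟩

/-- An edge other than `f` has an endpoint outside `f`, where the weight is zero; its minimal weight
is then zero and halving it changes nothing. -/
theorem bisectWeightIf_of_ne {F : Finset (Finset Plane)} {e f : Finset Plane} {w : Plane → ℝ}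
    (he : e.card = 2) (hf : f.card = 2) (hef : e ≠ f) (h0 : ∀ z, 0 ≤ w z)
    (hw : ∀ z, z ∉ f → w z = 0) : bisectWeightIf F e w = w := by
  unfold bisectWeightIf
  split_ifs
  · have : ¬ e ⊆ f := fun h => hef (Finset.eq_of_subset_of_card_le h (by omega))
    obtain ⟨z, hz, hz'⟩ := Finset.not_subset.1 this
    exact bisectWeight_of_minWeight_eq_zero (minWeight_eq_zero h0 hz (hw z hz'))
  · rfl

theorem bisectWeightIf_of_eq_zero {F : Finset (Finset Plane)} {e : Finset Plane} {w : Plane → ℝ}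
    (h0 : ∀ z, 0 ≤ w z) {z : Plane} (hz : z ∈ e) (hw : w z = 0) : bisectWeightIf F e w = w := by
  unfold bisectWeightIf
  split_ifs
  · exact bisectWeight_of_minWeight_eq_zero (minWeight_eq_zero h0 hz hw)
  · rfl

/-- On an edge `f` the refinement is determined by whether `f` is halved. -/
theorem bisectWeightIf_face {σ : ℝ} {F : Finset (Finset Plane)} {K K' : MarkedTriangle}
    (hK : IsShapeRegular σ K) (hF : ∀ E ∈ F, E ⊆ K.1 → K.2 ∈ F) (hK' : K' ∈ bisectIf F K)
    {x : Plane} {w w' : Plane → ℝ} (hw : IsWeight K.1 x w) (hw' : IsWeight K'.1 x w')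
    (hww' : w' = bisectWeightIf F K.2 w) {f : Finset Plane} (hfK : f ⊆ K.1) (hf : f.card = 2)
    (hwf : ∀ z, z ∉ f → w z = 0) :
    bisectWeightIf F K'.2 w' = bisectWeightIf F f w := by
  classical
  by_cases hKF : K.2 ∈ F
  · rw [bisectIf, if_pos hKF] at hK'
    have hKc := hK.ref_card
    have hK'c := (hK.bisect hK').ref_card
    obtain ⟨p, q, c, rfl, h, hσ, rfl⟩ := exists_of_mem_bisect hK hK'
    obtain ⟨d1, d2, d3⟩ := cross_ne_zero_distinct h
    obtain ⟨m1, m2, m3⟩ := midpoint_ne h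
    dsimp only at *
    by_cases hfe : f = {p, q}
    -- If `f` is the reference edge, the point has weight zero at `c`, an endpoint of the son's
    -- reference edge, so a second bisection has no effect.
    · subst hfe
      have : w' c = 0 := by
        rw [hww', bisectWeightIf, if_pos hKF]
        simp [bisectWeight, d2.symm, d3.symm, edgeMidpoint_pair d1, m3.symm, -one_div, -smul_add,
          hwf c]
      rw [bisectWeightIf_of_eq_zero hw'.nonneg (z := c) (by simp) this, hww']
    · have hw'w : w' = w := by
        rw [hww', bisectWeightIf_of_ne hKc hf (Ne.symm hfe) hw.nonneg hwf]
      rw [hw'w] at hw' ⊢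
      by_cases hfe2 : f = {q, c}
      · rw [hfe2]
      -- The remaining edge contains `p`, which the son lacks; so the weight at `p` is zero and
      -- halving `f` has no effect either.
      · rw [bisectWeightIf_of_ne hK'c hf (Ne.symm hfe2) hw.nonneg hwf]
        have hp : p ∈ f := by
          by_contra hp
          refine hfe2 (Finset.eq_of_subset_of_card_le (fun z hz => ?_) (by omega))
          have h1 := hfK hz
          have h2 : z ≠ p := fun h => hp (h ▸ hz)
          simpa [h2] using h1
        exact (bisectWeightIf_of_eq_zero hw.nonneg hp (hw'.eq_zero p
          (by simp [d1, d2, m1.symm, -one_div, -smul_add]))).symm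
  -- By the closure condition on `F`, no edge is halved if the reference edge is not.
  · have hfF : f ∉ F := fun h => hKF (hF f h hfK)
    rw [bisectIf, if_neg hKF, Finset.mem_singleton] at hK'
    subst hK'
    rw [hww']
    simp [bisectWeightIf, hKF, hfF]

/-- Conforming, shape regular triangulations with reference edges. Conformity is expressed by the
uniqueness of barycentric weights. -/
structure IsMarkedTriangulation (Ω : Set Plane) (σ : ℝ) (M : MarkedMesh) : Prop where
  shape : ∀ K ∈ M, IsShapeRegular σ K
  iUnion_eq : ⋃ K ∈ M, convexHull ℝ (K.1 : Set Plane) = closure Ω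
  weight_eq : ∀ K ∈ M, ∀ L ∈ M, ∀ x w w', IsWeight K.1 x w → IsWeight L.1 x w' → w = w'
  eq_of_pos : ∀ K ∈ M, ∀ L ∈ M, ∀ x w, IsWeight K.1 x w → IsWeight L.1 x w →
    (∀ z ∈ K.1, 0 < w z) → K = L

/-! ### One refinement step. -/

section Step

variable {Ω : Set Plane} {σ : ℝ} {M : MarkedMesh} {F : Finset (Finset Plane)}

/-- Barycentric weights of a refined element stem from barycentric weights of its father. -/
theorem exists_weight_of_mem_refineElement {K K'' : MarkedTriangle} (hK : IsShapeRegular σ K)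
    (hF : ∀ E ∈ F, E ⊆ K.1 → K.2 ∈ F) (hK'' : K'' ∈ refineElement F K) {x : Plane}
    {w'' : Plane → ℝ} (hw'' : IsWeight K''.1 x w'') :
    ∃ w, IsWeight K.1 x w ∧
      (∀ f ⊆ K.1, f.card = 2 → (∀ z, z ∉ f → w z = 0) → w'' = bisectWeightIf F f w) ∧
      (∀ L'' ∈ refineElement F K, ∀ v, IsWeight L''.1 x v → v = w'') ∧
      ((∀ z ∈ K''.1, 0 < w'' z) → (∀ z ∈ K.1, 0 < w z) ∧
        ∀ L'' ∈ refineElement F K, IsWeight L''.1 x w'' → L'' = K'') := by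
  classical
  obtain ⟨K', hK', hK''⟩ := mem_refineElement.1 hK''
  obtain ⟨w', hw', hww', hpos'⟩ := exists_weight_of_mem_bisectIf (hK.bisectIf hK') hK'' hw''
  obtain ⟨w, hw, hww, hpos⟩ := exists_weight_of_mem_bisectIf hK hK' hw'
  refine ⟨w, hw, fun f hf hf2 hwf => ?_, fun L'' hL'' v hv => ?_, fun hp => ?_⟩
  · rw [hww', bisectWeightIf_face hK hF hK' hw hw' hww hf hf2 hwf]
  · obtain ⟨L', hL', hL''⟩ := mem_refineElement.1 hL''
    obtain ⟨v', hv', hvv', -⟩ := exists_weight_of_mem_bisectIf (hK.bisectIf hL') hL'' hv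
    obtain ⟨v₀, hv₀, hvv, -⟩ := exists_weight_of_mem_bisectIf hK hL' hv'
    have hvw : v₀ = w := hK.weight_unique hv₀ hw
    have hvw' : v' = w' := by rw [hvv, hww, hvw]
    subst hvw hvw'
    by_cases hLK : L' = K'
    · rw [hvv', hww', hLK]
    by_cases hKF : K.2 ∈ F
    · rw [bisectIf, if_pos hKF] at hK' hL'
      obtain ⟨p, q, c, rfl, h, hσ, rfl⟩ := exists_of_mem_bisect hK hK'
      obtain ⟨d1, d2, d3⟩ := cross_ne_zero_distinct h
      obtain ⟨m1, m2, m3⟩ := midpoint_ne h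
      simp only [bisect, Finset.mem_image, Finset.mem_insert, Finset.mem_singleton,
        edgeMidpoint_pair d1] at hL'
      obtain ⟨r, rfl | rfl, rfl⟩ := hL'
      · exfalso
        apply hLK
        have : ({r, q, c} : Finset Plane).erase r = {q, c} :=
          Finset.erase_insert (by simp [d1, d2])
        rw [this, Finset.insert_comm, Finset.pair_comm _ c]
      -- A point common to both sons has weight zero at both ends of the old reference edge. Each
      -- son's reference edge contains one of these ends, so the second bisection leaves the weights
      -- alone on either side.
      · have hr : v' r = 0 := hv'.eq_zero r (by simp [m2.symm, -one_div, -smul_add])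
        have hp : v' p = 0 := hw'.eq_zero p (by simp [d1, d2, m1.symm, -one_div, -smul_add])
        rw [hvv', hww', bisectWeightIf_of_eq_zero hw'.nonneg (z := p) (by simp [d1, d2]) hp,
          bisectWeightIf_of_eq_zero hw'.nonneg (z := r) (by simp) hr]
    · rw [bisectIf, if_neg hKF, Finset.mem_singleton] at hK' hL'
      exact absurd (hL'.trans hK'.symm) hLK
  · obtain ⟨h1, h2⟩ := hpos' hp
    obtain ⟨h3, h4⟩ := hpos h1
    refine ⟨h3, fun L'' hL'' hv => ?_⟩
    obtain ⟨L', hL', hL''⟩ := mem_refineElement.1 hL''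
    obtain ⟨v', hv', hvv', -⟩ := exists_weight_of_mem_bisectIf (hK.bisectIf hL') hL'' hv
    obtain ⟨v₀, hv₀, hvv, -⟩ := exists_weight_of_mem_bisectIf hK hL' hv'
    have hvw : v₀ = w := hK.weight_unique hv₀ hw
    have hvw' : v' = w' := by rw [hvv, hww, hvw]
    subst hvw hvw'
    have := h4 L' hL' hv'
    subst this
    exact h2 L'' hL'' hv

theorem IsShapeRegular.refineElement {K K'' : MarkedTriangle} (hK : IsShapeRegular σ K)
    (hK'' : K'' ∈ refineElement F K) : IsShapeRegular σ K'' := by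
  obtain ⟨K', hK', hK''⟩ := mem_refineElement.1 hK''
  exact (hK.bisectIf hK').bisectIf hK''

theorem refineElement_exists_mem {K : MarkedTriangle} (hK : IsShapeRegular σ K) {x : Plane}
    {w : Plane → ℝ} (hw : IsWeight K.1 x w) :
    ∃ K'' ∈ refineElement F K, ∃ w'', IsWeight K''.1 x w'' := by
  obtain ⟨K', hK', w', hw'⟩ := bisectIf_exists_mem (F := F) hK hw
  obtain ⟨K'', hK'', w'', hw''⟩ := bisectIf_exists_mem (F := F) (hK.bisectIf hK') hw'
  exact ⟨K'', mem_refineElement.2 ⟨K', hK', hK''⟩, w'', hw''⟩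

theorem exists_card_two_of_not_pos {K : MarkedTriangle} (hK : IsShapeRegular σ K) {x : Plane}
    {w : Plane → ℝ} (hw : IsWeight K.1 x w) (h : ¬ ∀ z ∈ K.1, 0 < w z) :
    ∃ f ⊆ K.1, f.card = 2 ∧ ∀ z, z ∉ f → w z = 0 := by
  classical
  push Not at h
  obtain ⟨z, hz, hwz⟩ := h
  refine ⟨K.1.erase z, Finset.erase_subset _ _, ?_, fun y hy => ?_⟩
  · rw [Finset.card_erase_of_mem hz, hK.card_eq]
  · by_cases hyz : y = z
    · rw [hyz]; exact le_antisymm hwz (hw.nonneg z)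
    · exact hw.eq_zero y fun h => hy (Finset.mem_erase.2 ⟨hyz, h⟩)

/-- Within one father the weights are determined by the father's. A point shared by two fathers is
interior to neither, so its weights are carried by an edge of each, and there the refinement rule
depends on the edge alone. -/
theorem IsMarkedTriangulation.step (hM : IsMarkedTriangulation Ω σ M)
    (hF : ∀ K ∈ M, ∀ E ∈ F, E ⊆ K.1 → K.2 ∈ F) {M' : MarkedMesh}
    (hM' : ∀ K'', K'' ∈ M' ↔ ∃ K ∈ M, K'' ∈ refineElement F K) : IsMarkedTriangulation Ω σ M' := by
  classical
  refine ⟨fun K'' hK'' => ?_, ?_, ?_, ?_⟩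
  · obtain ⟨K, hK, hK''⟩ := (hM' K'').1 hK''
    exact (hM.shape K hK).refineElement hK''
  · rw [← hM.iUnion_eq]
    ext x
    simp only [mem_iUnion, mem_convexHull_iff_exists_isWeight, exists_prop]
    constructor
    · rintro ⟨K'', hK'', w'', hw''⟩
      obtain ⟨K, hK, hK''⟩ := (hM' K'').1 hK''
      obtain ⟨w, hw, -⟩ := exists_weight_of_mem_refineElement (hM.shape K hK) (hF K hK) hK'' hw''
      exact ⟨K, hK, w, hw⟩
    · rintro ⟨K, hK, w, hw⟩
      obtain ⟨K'', hK'', w'', hw''⟩ := refineElement_exists_mem (F := F) (hM.shape K hK) hw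
      exact ⟨K'', (hM' K'').2 ⟨K, hK, hK''⟩, w'', hw''⟩
  · intro K'' hK'' L'' hL'' x w'' v'' hw'' hv''
    obtain ⟨K, hK, hK''⟩ := (hM' K'').1 hK''
    obtain ⟨L, hL, hL''⟩ := (hM' L'').1 hL''
    have sK := hM.shape K hK
    have sL := hM.shape L hL
    obtain ⟨w, hw, hw1, hw2, -⟩ := exists_weight_of_mem_refineElement sK (hF K hK) hK'' hw''
    by_cases hKL : K = L
    · subst hKL
      exact (hw2 L'' hL'' _ hv'').symm
    obtain ⟨v, hv, hv1, -, -⟩ := exists_weight_of_mem_refineElement sL (hF L hL) hL'' hv''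
    obtain rfl := hM.weight_eq K hK L hL x w v hw hv
    obtain ⟨f, hfK, hf2, hwf⟩ := exists_card_two_of_not_pos sK hw
      fun hp => hKL (hM.eq_of_pos K hK L hL x w hw hv hp)
    obtain ⟨e, heL, he2, hwe⟩ := exists_card_two_of_not_pos sL hv
      fun hp => hKL (hM.eq_of_pos L hL K hK x w hv hw hp).symm
    rw [hw1 f hfK hf2 hwf, hv1 e heL he2 hwe]
    -- If the two edges differ, the weights are supported on both, so halving either one changes
    -- nothing.
    by_cases hef : e = f
    · rw [hef]
    · rw [bisectWeightIf_of_ne he2 hf2 hef hw.nonneg hwf,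
        bisectWeightIf_of_ne hf2 he2 (Ne.symm hef) hw.nonneg hwe]
  · intro K'' hK'' L'' hL'' x w'' hw'' hv'' hpos
    obtain ⟨K, hK, hK''⟩ := (hM' K'').1 hK''
    obtain ⟨L, hL, hL''⟩ := (hM' L'').1 hL''
    have sK := hM.shape K hK
    have sL := hM.shape L hL
    obtain ⟨w, hw, -, -, hw1⟩ := exists_weight_of_mem_refineElement sK (hF K hK) hK'' hw''
    obtain ⟨v, hv, -⟩ := exists_weight_of_mem_refineElement sL (hF L hL) hL'' hv''
    obtain rfl := hM.weight_eq K hK L hL x w v hw hv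
    obtain ⟨h1, h2⟩ := hw1 hpos
    obtain rfl := hM.eq_of_pos K hK L hL x w hw hv h1
    exact (h2 L'' hL'' hv'').symm

end Step

open Classical in
theorem cross_ne_zero_of_affineIndependent {p q c : Plane} (hpq : p ≠ q) (hpc : p ≠ c)
    (hqc : q ≠ c)
    (h : AffineIndependent ℝ ((↑) : (({p, q, c} : Finset Plane) : Set Plane) → Plane)) :
    cross (p - c) (q - c) ≠ 0 := by
  intro h0
  have key : ∀ α β γ : ℝ, α + β + γ = 0 → α • p + β • q + γ • c = 0 → α = 0 ∧ β = 0 := by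
    intro α β γ h1 h2
    have v1 : tripleWeight p q c α β γ p = α := by simp [tripleWeight]
    have v2 : tripleWeight p q c α β γ q = β := by simp [tripleWeight, hpq.symm]
    have v3 : tripleWeight p q c α β γ c = γ := by simp [tripleWeight, hpc.symm, hqc.symm]
    have hs : ∀ {X : Type} [AddCommMonoid X] (f : Plane → X),
        ∑ z ∈ ({p, q, c} : Finset Plane), f z = f p + f q + f c := fun f => by
      rw [Finset.sum_insert (by simp [hpq, hpc]), Finset.sum_pair hqc, add_assoc]
    rw [affineIndependent_iff] at h
    have := h Finset.univ (fun z => tripleWeight p q c α β γ z)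
      (by
        refine (Finset.sum_coe_sort ({p, q, c} : Finset Plane) (tripleWeight p q c α β γ)).trans ?_
        rw [hs, v1, v2, v3, h1])
      (by
        refine (Finset.sum_coe_sort ({p, q, c} : Finset Plane)
          (fun z => tripleWeight p q c α β γ z • z)).trans ?_
        rw [hs, v1, v2, v3, h2])
    exact ⟨by simpa [v1] using this ⟨p, by simp⟩ (Finset.mem_univ _),
      by simpa [v2] using this ⟨q, by simp⟩ (Finset.mem_univ _)⟩
  simp only [cross, PiLp.sub_apply] at h0
  -- If the cross product vanishes, either coordinate of `q - c` and `p - c` supplies the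
  -- coefficients of an affine dependence; both together force `q = c`.
  have k0 := key (q 0 - c 0) (-(p 0 - c 0)) (-(q 0 - c 0) + (p 0 - c 0)) (by ring) (by
    refine plane_ext ?_ ?_ <;> simp only [PiLp.add_apply, PiLp.smul_apply, smul_eq_mul,
      PiLp.zero_apply]
    · ring
    · linear_combination -h0)
  have k1 := key (q 1 - c 1) (-(p 1 - c 1)) (-(q 1 - c 1) + (p 1 - c 1)) (by ring) (by
    refine plane_ext ?_ ?_ <;> simp only [PiLp.add_apply, PiLp.smul_apply, smul_eq_mul,
      PiLp.zero_apply]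
    · linear_combination h0
    · ring)
  exact hqc (plane_ext (by linarith [k0.1]) (by linarith [k1.1]))

/-- Two elements meet in the hull of their common vertices, so a shared point has weights on these
vertices, which by uniqueness are its weights in both elements. -/
theorem IsTriangulation.isMarkedTriangulation {Ω : Set Plane} {T : Finset (Finset Plane)}
    (hT : IsTriangulation Ω T) : ∃ σ : ℝ, ∀ M : MarkedMesh,
      (∃ ref : Finset Plane → Finset Plane, (∀ t ∈ T, ref t ∈ t.powersetCard 2) ∧
        ∀ K, K ∈ M ↔ ∃ t ∈ T, K = (t, ref t)) → IsMarkedTriangulation Ω σ M := by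
  classical
  -- The maximum over all ordered triples of nodes does not depend on the choice of reference edges.
  obtain ⟨σ, hσ⟩ := (((nodes T) ×ˢ (nodes T) ×ˢ (nodes T)).image fun a : Plane × Plane × Plane =>
    (‖a.1 - a.2.2‖ ^ 2 + ‖a.2.1 - a.2.2‖ ^ 2) /
      |cross (a.1 - a.2.2) (a.2.1 - a.2.2)|).exists_le
  refine ⟨σ, fun M ⟨ref, href, hM⟩ => ?_⟩
  have shape : ∀ K ∈ M, IsShapeRegular σ K := by
    intro K hK
    obtain ⟨t, ht, rfl⟩ := (hM K).1 hK
    obtain ⟨hrt, hr2⟩ := Finset.mem_powersetCard.1 (href t ht)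
    obtain ⟨p, q, hpq, hr⟩ := Finset.card_eq_two.1 hr2
    have hc : (t \ ref t).card = 1 := by
      rw [Finset.card_sdiff_of_subset hrt, hT.card_eq t ht, hr2]
    obtain ⟨c, hc⟩ := Finset.card_eq_one.1 hc
    have htc : t = {p, q, c} := by
      rw [← Finset.sdiff_union_of_subset hrt, hc, hr]
      ext z
      simp only [Finset.mem_union, Finset.mem_insert, Finset.mem_singleton]
      tauto
    have hcr : c ∉ ref t := (Finset.mem_sdiff.1 (hc ▸ Finset.mem_singleton_self c)).2
    simp only [hr, Finset.mem_insert, Finset.mem_singleton, not_or] at hcr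
    have hcross := cross_ne_zero_of_affineIndependent hpq (Ne.symm hcr.1) (Ne.symm hcr.2)
      (htc ▸ hT.affineIndependent t ht)
    refine ⟨p, q, c, by rw [hr, htc], hcross, ?_⟩
    have hn : ∀ z ∈ t, z ∈ nodes T := fun z hz => Finset.mem_biUnion.2 ⟨t, ht, hz⟩
    have := hσ _ (Finset.mem_image_of_mem _ (Finset.mk_mem_product (hn p (by simp [htc]))
      (Finset.mk_mem_product (hn q (by simp [htc])) (hn c (by simp [htc])))))
    rwa [div_le_iff₀ (abs_pos.2 hcross)] at this
  have weq : ∀ K ∈ M, ∀ L ∈ M, ∀ x w w', IsWeight K.1 x w → IsWeight L.1 x w' →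
      w = w' ∧ ∀ z, z ∉ K.1 ∩ L.1 → w z = 0 := by
    intro K hK L hL x w w' hw hw'
    have sK := shape K hK
    have sL := shape L hL
    obtain ⟨t, ht, rfl⟩ := (hM K).1 hK
    obtain ⟨s, hs, rfl⟩ := (hM L).1 hL
    have hx : x ∈ convexHull ℝ ((t ∩ s : Finset Plane) : Set Plane) := by
      rw [Finset.coe_inter, ← hT.inter_eq t ht s hs]
      exact ⟨mem_convexHull_iff_exists_isWeight.2 ⟨w, hw⟩,
        mem_convexHull_iff_exists_isWeight.2 ⟨w', hw'⟩⟩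
    obtain ⟨v, hv⟩ := mem_convexHull_iff_exists_isWeight.1 hx
    have h1 := sK.weight_unique hw (hv.mono Finset.inter_subset_left)
    have h2 := sL.weight_unique hw' (hv.mono Finset.inter_subset_right)
    exact ⟨h1.trans h2.symm, fun z hz => by rw [h1]; exact hv.eq_zero z hz⟩
  refine ⟨shape, ?_, fun K hK L hL x w w' hw hw' => (weq K hK L hL x w w' hw hw').1, ?_⟩
  · rw [← hT.iUnion_eq]
    ext x
    simp only [mem_iUnion, hM]
    constructor
    · rintro ⟨_, ⟨t, ht, rfl⟩, hx⟩
      exact ⟨t, ht, hx⟩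
    · rintro ⟨t, ht, hx⟩
      exact ⟨_, ⟨t, ht, rfl⟩, hx⟩
  · intro K hK L hL x w hw hw' hpos
    have h0 := (weq K hK L hL x w w hw hw').2
    have hKL : K.1 ⊆ L.1 := fun z hz => by
      by_contra hzL
      exact (hpos z hz).ne' (h0 z fun h => hzL (Finset.mem_inter.1 h).2)
    have := Finset.eq_of_subset_of_card_le hKL
      (by rw [(shape K hK).card_eq, (shape L hL).card_eq])
    obtain ⟨t, ht, rfl⟩ := (hM K).1 hK
    obtain ⟨s, hs, rfl⟩ := (hM L).1 hL
    dsimp only at this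
    rw [this]

theorem exists_isMarkedTriangulation {Ω : Set Plane} {T₀ : Finset (Finset Plane)}
    (hT : IsTriangulation Ω T₀) :
    ∃ σ : ℝ, ∀ M, IsNVBSequence T₀ M → ∀ l, IsMarkedTriangulation Ω σ (M l) := by
  classical
  obtain ⟨σ, hσ⟩ := hT.isMarkedTriangulation
  refine ⟨σ, fun M ⟨⟨ref, href, hM0⟩, hstep⟩ l => ?_⟩
  induction l with
  | zero =>
    refine hσ _ ⟨ref, href, fun K => ?_⟩
    rw [hM0]
    simp [eq_comm]
  | succ l ih =>
    obtain ⟨F, -, hF, hM'⟩ := hstep l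
    exact ih.step hF fun K'' => by rw [hM', Finset.mem_biUnion]

/-! ### Interior and boundary edges -/

theorem IsWeight.combo {s : Finset Plane} {x y : Plane} {w v : Plane → ℝ} (hw : IsWeight s x w)
    (hv : IsWeight s y v) {a b : ℝ} (ha : 0 ≤ a) (hb : 0 ≤ b) (hab : a + b = 1) :
    IsWeight s (a • x + b • y) (fun z => a * w z + b * v z) where
  nonneg z := add_nonneg (mul_nonneg ha (hw.nonneg z)) (mul_nonneg hb (hv.nonneg z))
  eq_zero z hz := by simp [hw.eq_zero z hz, hv.eq_zero z hz]
  sum_eq_one := by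
    rw [Finset.sum_add_distrib, ← Finset.mul_sum, ← Finset.mul_sum, hw.sum_eq_one, hv.sum_eq_one]
    linarith
  sum_smul := by
    simp_rw [add_smul, mul_smul]
    rw [Finset.sum_add_distrib, ← Finset.smul_sum, ← Finset.smul_sum, hw.sum_smul, hv.sum_smul]

open Classical in
theorem isWeight_vertex {s : Finset Plane} {c : Plane} (hc : c ∈ s) :
    IsWeight s c (fun z => if z = c then 1 else 0) where
  nonneg z := by split_ifs <;> norm_num
  eq_zero z hz := by simp [ne_of_mem_of_not_mem hc hz |>.symm]
  sum_eq_one := by simp [hc]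
  sum_smul := by simp [hc]

open Classical in
theorem isWeight_pair {s : Finset Plane} {a b : Plane} (ha : a ∈ s) (hb : b ∈ s) {α β : ℝ}
    (hα : 0 ≤ α) (hβ : 0 ≤ β) (hab : α + β = 1) : IsWeight s (α • a + β • b)
      (fun z => α * (if z = a then 1 else 0) + β * (if z = b then 1 else 0)) :=
  (isWeight_vertex ha).combo (isWeight_vertex hb) hα hβ hab

/-- The three quotients of signed areas are the barycentric coordinates of `y`. -/
theorem mem_convexHull_of_cross {a b c y : Plane} {s : Finset Plane}
    (hs : ∀ z, z ∈ s ↔ z = a ∨ z = b ∨ z = c)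
    (h : cross (a - c) (b - c) ≠ 0)
    (h1 : 0 ≤ cross (y - c) (b - c) / cross (a - c) (b - c))
    (h2 : 0 ≤ cross (a - c) (y - c) / cross (a - c) (b - c))
    (h3 : 0 ≤ cross (a - y) (b - y) / cross (a - c) (b - c)) :
    y ∈ convexHull ℝ (s : Set Plane) := by
  classical
  obtain rfl : s = {a, b, c} := by ext z; simp [hs]
  have H := isWeight_tripleWeight h h1 h2 h3 (by
    rw [← add_div, ← add_div, div_eq_one_iff_eq h]
    simp only [cross, PiLp.sub_apply]; ring)
  have hy : (cross (y - c) (b - c) / cross (a - c) (b - c)) • a +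
      (cross (a - c) (y - c) / cross (a - c) (b - c)) • b +
      (cross (a - y) (b - y) / cross (a - c) (b - c)) • c = y := by
    refine plane_ext ?_ ?_ <;>
    · simp only [PiLp.add_apply, PiLp.smul_apply, smul_eq_mul, div_mul_eq_mul_div]
      rw [← add_div, ← add_div, div_eq_iff h]
      simp only [cross, PiLp.sub_apply]; ring
  exact mem_convexHull_iff_exists_isWeight.2 ⟨_, hy ▸ H⟩

theorem IsShapeRegular.exists_third {σ : ℝ} {K : MarkedTriangle} (hK : IsShapeRegular σ K)
    {a b : Plane} (hab : a ≠ b) (ha : a ∈ K.1) (hb : b ∈ K.1) :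
    ∃ c, (∀ z, z ∈ K.1 ↔ z = a ∨ z = b ∨ z = c) ∧ cross (a - c) (b - c) ≠ 0 := by
  classical
  obtain ⟨p, q, r, rfl, h, -⟩ := hK
  simp only [Finset.mem_insert, Finset.mem_singleton] at ha hb ⊢
  have h1 : cross (q - r) (p - r) ≠ 0 := by rw [cross_swap]; exact neg_ne_zero.2 h
  have h2 : cross (q - p) (r - p) ≠ 0 := by
    convert h using 1; simp only [cross, PiLp.sub_apply]; ring
  have h3 : cross (r - p) (q - p) ≠ 0 := by rw [cross_swap]; exact neg_ne_zero.2 h2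
  have h4 : cross (r - q) (p - q) ≠ 0 := by
    convert h using 1; simp only [cross, PiLp.sub_apply]; ring
  have h5 : cross (p - q) (r - q) ≠ 0 := by rw [cross_swap]; exact neg_ne_zero.2 h4
  rcases ha with rfl | rfl | rfl <;> rcases hb with rfl | rfl | rfl
  · exact absurd rfl hab
  · exact ⟨r, fun z => by tauto, h⟩
  · exact ⟨q, fun z => by tauto, h5⟩
  · exact ⟨r, fun z => by tauto, h1⟩
  · exact absurd rfl hab
  · exact ⟨p, fun z => by tauto, h2⟩
  · exact ⟨q, fun z => by tauto, h4⟩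
  · exact ⟨p, fun z => by tauto, h3⟩
  · exact absurd rfl hab

theorem mem_elements {M : MarkedMesh} {t : Finset Plane} :
    t ∈ elements M ↔ ∃ K ∈ M, K.1 = t := by
  simp [elements]

theorem mem_edges {M : MarkedMesh} {E : Finset Plane} :
    E ∈ edges (elements M) ↔ ∃ K ∈ M, E ⊆ K.1 ∧ E.card = 2 := by
  simp only [edges, Finset.mem_biUnion, mem_elements, Finset.mem_powersetCard]
  constructor
  · rintro ⟨_, ⟨K, hK, rfl⟩, h⟩
    exact ⟨K, hK, h⟩
  · rintro ⟨K, hK, h⟩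
    exact ⟨_, ⟨K, hK, rfl⟩, h⟩

theorem mem_boundaryEdges {M : MarkedMesh} {E : Finset Plane} :
    E ∈ boundaryEdges (elements M) ↔ (∃ K ∈ M, E ⊆ K.1 ∧ E.card = 2) ∧
      ∀ K ∈ M, ∀ L ∈ M, K.1 ∩ L.1 ≠ E := by
  classical
  simp only [boundaryEdges, Finset.mem_filter, mem_edges, mem_elements]
  refine and_congr_right fun _ => ⟨fun h K hK L hL hKL => ?_, ?_⟩
  · exact h ⟨K.1, ⟨K, hK, rfl⟩, L.1, ⟨L, hL, rfl⟩, by convert hKL⟩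
  · rintro h ⟨_, ⟨K, hK, rfl⟩, _, ⟨L, hL, rfl⟩, hKL⟩
    exact h K hK L hL (by convert hKL)

theorem mem_nodes {M : MarkedMesh} {z : Plane} :
    z ∈ nodes (elements M) ↔ ∃ K ∈ M, z ∈ K.1 := by
  simp only [nodes, Finset.mem_biUnion, mem_elements]
  constructor
  · rintro ⟨_, ⟨K, hK, rfl⟩, h⟩
    exact ⟨K, hK, h⟩
  · rintro ⟨K, hK, h⟩
    exact ⟨_, ⟨K, hK, rfl⟩, h⟩

theorem isClosed_convexHull_finset (s : Finset Plane) :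
    IsClosed (convexHull ℝ (s : Set Plane)) :=
  s.finite_toSet.isClosed_convexHull ℝ

section Mesh

variable {Ω : Set Plane} {σ : ℝ} {M : MarkedMesh}

/-- The barycentre has positive weight at every vertex, so `eq_of_pos` applies to it. -/
theorem IsMarkedTriangulation.eq_of_fst_eq (hM : IsMarkedTriangulation Ω σ M)
    {K L : MarkedTriangle} (hK : K ∈ M) (hL : L ∈ M) (h : K.1 = L.1) : K = L := by
  classical
  obtain ⟨p, q, c, hpqc, hc, -⟩ := hM.shape K hK
  have H := isWeight_tripleWeight hc (α := 1 / 3) (β := 1 / 3) (γ := 1 / 3) (by norm_num)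
    (by norm_num) (by norm_num) (by norm_num)
  have hK1 : K.1 = {p, q, c} := by rw [hpqc]
  rw [← hK1] at H
  refine hM.eq_of_pos K hK L hL _ _ H (h ▸ H) fun z hz => ?_
  obtain ⟨h1, h2, h3⟩ := tripleWeight_values hc (1 / 3) (1 / 3) (1 / 3)
  simp only [hK1, Finset.mem_insert, Finset.mem_singleton] at hz
  rcases hz with rfl | rfl | rfl
  · rw [h1]; norm_num
  · rw [h2]; norm_num
  · rw [h3]; norm_num

/-- Two elements with different vertex sets share at most two vertices, so they would meet exactly
in `E`, which is excluded for a boundary edge. -/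
theorem IsMarkedTriangulation.eq_of_boundaryEdge_subset (hM : IsMarkedTriangulation Ω σ M)
    {E : Finset Plane} (hE : E ∈ boundaryEdges (elements M)) {K L : MarkedTriangle} (hK : K ∈ M)
    (hL : L ∈ M) (hEK : E ⊆ K.1) (hEL : E ⊆ L.1) : K = L := by
  classical
  obtain ⟨⟨-, -, -, hE2⟩, hEb⟩ := mem_boundaryEdges.1 hE
  apply hM.eq_of_fst_eq hK hL
  by_contra hne
  have h1 := (hM.shape K hK).card_eq
  have h2 := (hM.shape L hL).card_eq
  refine hEb K hK L hL (Finset.eq_of_subset_of_card_le (Finset.subset_inter hEK hEL) ?_).symm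
  have : K.1 ∩ L.1 ⊂ K.1 := by
    refine Finset.inter_subset_left.ssubset_of_ne fun h => hne ?_
    exact Finset.eq_of_subset_of_card_le (Finset.inter_eq_left.1 h) (by omega)
  have := Finset.card_lt_card this
  omega

/-- Any element containing `x` contains `E`, hence is `K`. If `x` were in Ω, all points near `x`
would lie in `K`, including those slightly beyond `x` as seen from the opposite vertex `c`. -/
theorem IsMarkedTriangulation.notMem_of_weight (hM : IsMarkedTriangulation Ω σ M)
    (hΩ : IsOpen Ω) {E : Finset Plane} (hE : E ∈ boundaryEdges (elements M)) {x : Plane}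
    {w : Plane → ℝ} (hw : IsWeight E x w) (hpos : ∀ z ∈ E, 0 < w z) : x ∉ Ω := by
  classical
  intro hx
  obtain ⟨⟨K, hK, hEK, hE2⟩, -⟩ := mem_boundaryEdges.1 hE
  have hwK := hw.mono hEK
  obtain ⟨c, hc⟩ : (K.1 \ E).Nonempty := by
    rw [← Finset.card_pos, Finset.card_sdiff_of_subset hEK, (hM.shape K hK).card_eq, hE2]
    norm_num
  obtain ⟨hcK, hcE⟩ := Finset.mem_sdiff.1 hc
  set U : Set Plane := Ω \ ⋃ L ∈ M.erase K, convexHull ℝ (L.1 : Set Plane) with hU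
  have hUo : IsOpen U :=
    hΩ.sdiff ((M.erase K).finite_toSet.isClosed_biUnion fun L _ => isClosed_convexHull_finset L.1)
  have hxU : x ∈ U := by
    refine ⟨hx, fun h => ?_⟩
    simp only [mem_iUnion, exists_prop] at h
    obtain ⟨L, hL, hxL⟩ := h
    obtain ⟨hLK, hL⟩ := Finset.mem_erase.1 hL
    obtain ⟨v, hv⟩ := mem_convexHull_iff_exists_isWeight.1 hxL
    obtain rfl := hM.weight_eq K hK L hL x w v hwK hv
    refine hLK (hM.eq_of_boundaryEdge_subset hE hL hK (fun z hz => ?_) hEK)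
    by_contra hzL
    exact (hpos z hz).ne' (hv.eq_zero z hzL)
  have hcont : Filter.Tendsto (fun ε : ℝ => x + ε • (x - c)) (nhdsWithin 0 (Ioi 0)) (nhds x) := by
    have : Continuous fun ε : ℝ => x + ε • (x - c) := by fun_prop
    have h0 := this.tendsto 0
    simp only [zero_smul, add_zero] at h0
    exact h0.mono_left nhdsWithin_le_nhds
  obtain ⟨ε, hεU, hε⟩ := ((hcont.eventually (hUo.mem_nhds hxU)).and self_mem_nhdsWithin).exists
  have hε : 0 < ε := hε
  have hy : x + ε • (x - c) ∈ convexHull ℝ (K.1 : Set Plane) := by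
    have h1 := subset_closure hεU.1
    rw [← hM.iUnion_eq] at h1
    simp only [mem_iUnion, exists_prop] at h1
    obtain ⟨L, hL, hyL⟩ := h1
    by_cases hLK : L = K
    · exact hLK ▸ hyL
    · exfalso
      refine hεU.2 ?_
      simp only [mem_iUnion, exists_prop]
      exact ⟨L, Finset.mem_erase.2 ⟨hLK, hL⟩, hyL⟩
  obtain ⟨v, hv⟩ := mem_convexHull_iff_exists_isWeight.1 hy
  have h1ε : 0 < 1 + ε := by linarith
  -- Going back towards `c` recovers `x` with positive weight at `c`, although `x` is on the
  -- opposite edge.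
  have H := hv.combo (isWeight_vertex hcK) (a := 1 / (1 + ε)) (b := ε / (1 + ε)) (by positivity)
    (by positivity) (by field_simp)
  have hx' : (1 / (1 + ε)) • (x + ε • (x - c)) + (ε / (1 + ε)) • c = x := by
    refine plane_ext ?_ ?_ <;>
    · simp only [PiLp.add_apply, PiLp.smul_apply, PiLp.sub_apply, smul_eq_mul]
      field_simp
      ring
  rw [hx'] at H
  have hwc := congrFun ((hM.shape K hK).weight_unique hwK H) c
  rw [hw.eq_zero c hcE] at hwc
  have : 0 < 1 / (1 + ε) * v c + ε / (1 + ε) * (if c = c then 1 else 0) := by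
    have := hv.nonneg c
    rw [if_pos rfl]
    positivity
  linarith

theorem mem_openSegment_iff_exists_isWeight {a b : Plane} (hab : a ≠ b) {E : Finset Plane}
    (hE : ∀ z, z ∈ E ↔ z = a ∨ z = b) {x : Plane} :
    x ∈ openSegment ℝ a b ↔ ∃ w, IsWeight E x w ∧ ∀ z ∈ E, 0 < w z := by
  classical
  have hEab : E = {a, b} := by ext z; simp [hE]
  constructor
  · rintro ⟨α, β, hα, hβ, hs, rfl⟩
    refine ⟨_, isWeight_pair ((hE a).2 (.inl rfl)) ((hE b).2 (.inr rfl)) hα.le hβ.le hs,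
      fun z hz => ?_⟩
    rcases (hE z).1 hz with rfl | rfl
    · simp [hab, hα]
    · simp [hab.symm, hβ]
  · rintro ⟨w, hw, hpos⟩
    refine ⟨w a, w b, hpos a ((hE a).2 (.inl rfl)), hpos b ((hE b).2 (.inr rfl)), ?_, ?_⟩
    · rw [← hw.sum_eq_one, hEab, Finset.sum_pair hab]
    · rw [← hw.sum_smul, hEab, Finset.sum_pair hab]

theorem IsMarkedTriangulation.segment_subset_frontier (hM : IsMarkedTriangulation Ω σ M)
    (hΩ : IsOpen Ω) {E : Finset Plane} (hEb : E ∈ boundaryEdges (elements M)) {a b : Plane}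
    (hab : a ≠ b) (hE : ∀ z, z ∈ E ↔ z = a ∨ z = b) : segment ℝ a b ⊆ frontier Ω := by
  rw [← closure_openSegment]
  refine closure_minimal (fun x hx => ?_) isClosed_frontier
  obtain ⟨w, hw, hpos⟩ := (mem_openSegment_iff_exists_isWeight hab hE).1 hx
  rw [hΩ.frontier_eq]
  refine ⟨?_, hM.notMem_of_weight hΩ hEb hw hpos⟩
  obtain ⟨⟨K, hK, hEK, -⟩, -⟩ := mem_boundaryEdges.1 hEb
  rw [← hM.iUnion_eq]
  simp only [mem_iUnion, exists_prop]
  exact ⟨K, hK, mem_convexHull_iff_exists_isWeight.2 ⟨w, hw.mono hEK⟩⟩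

/-- The endpoints of an edge are exactly the nodes of positive weight at any of its relative
interior points. -/
theorem IsMarkedTriangulation.disjoint_openSegment (hM : IsMarkedTriangulation Ω σ M)
    {E E' : Finset Plane} (hEb : E ∈ edges (elements M)) (hEb' : E' ∈ edges (elements M))
    {a b a' b' : Plane} (hab : a ≠ b) (hE : ∀ z, z ∈ E ↔ z = a ∨ z = b) (hab' : a' ≠ b')
    (hE' : ∀ z, z ∈ E' ↔ z = a' ∨ z = b') (hEE' : E ≠ E') :
    Disjoint (openSegment ℝ a b) (openSegment ℝ a' b') := by
  rw [Set.disjoint_left]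
  intro x hx hx'
  obtain ⟨w, hw, hpos⟩ := (mem_openSegment_iff_exists_isWeight hab hE).1 hx
  obtain ⟨v, hv, hpos'⟩ := (mem_openSegment_iff_exists_isWeight hab' hE').1 hx'
  obtain ⟨K, hK, hEK, -⟩ := mem_edges.1 hEb
  obtain ⟨L, hL, hEL, -⟩ := mem_edges.1 hEb'
  obtain rfl := hM.weight_eq K hK L hL x w v (hw.mono hEK) (hv.mono hEL)
  apply hEE'
  ext z
  constructor
  · intro hz
    by_contra h
    exact (hpos z hz).ne' (hv.eq_zero z h)
  · intro hz
    by_contra h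
    exact (hpos' z hz).ne' (hw.eq_zero z h)

/-- The midpoint of an edge shared by two elements lies inside the domain. -/
theorem IsMarkedTriangulation.midpoint_mem (hM : IsMarkedTriangulation Ω σ M)
    (hΩ : interior (closure Ω) = Ω) {K L : MarkedTriangle} (hK : K ∈ M) (hL : L ∈ M)
    {a b : Plane} (hab : a ≠ b) (h : ∀ z, z ∈ K.1 ∧ z ∈ L.1 ↔ z = a ∨ z = b) :
    (1 / 2 : ℝ) • (a + b) ∈ Ω := by
  classical
  have ha := (h a).2 (.inl rfl)
  have hb := (h b).2 (.inr rfl)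
  obtain ⟨c, hKc, hc⟩ := (hM.shape K hK).exists_third hab ha.1 hb.1
  obtain ⟨d, hLd, hd⟩ := (hM.shape L hL).exists_third hab ha.2 hb.2
  set m : Plane := (1 / 2 : ℝ) • (a + b) with hm
  -- Two barycentric coordinates are 1/2 at the midpoint and stay positive nearby; only the sign of
  -- the third decides membership.
  have hbary : ∀ e : Plane, cross (a - e) (b - e) ≠ 0 → ∀ᶠ y in nhds m,
      0 < cross (y - e) (b - e) / cross (a - e) (b - e) ∧
      0 < cross (a - e) (y - e) / cross (a - e) (b - e) := by
    intro e he
    have c1 : Continuous fun y : Plane => cross (y - e) (b - e) / cross (a - e) (b - e) := by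
      simp only [cross, PiLp.sub_apply]; fun_prop
    have c2 : Continuous fun y : Plane => cross (a - e) (y - e) / cross (a - e) (b - e) := by
      simp only [cross, PiLp.sub_apply]; fun_prop
    have e1 : cross (m - e) (b - e) / cross (a - e) (b - e) = 1 / 2 := by
      rw [div_eq_iff he]
      simp only [hm, cross, PiLp.sub_apply, PiLp.add_apply, PiLp.smul_apply, smul_eq_mul]; ring
    have e2 : cross (a - e) (m - e) / cross (a - e) (b - e) = 1 / 2 := by
      rw [div_eq_iff he]
      simp only [hm, cross, PiLp.sub_apply, PiLp.add_apply, PiLp.smul_apply, smul_eq_mul]; ring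
    have t1 := c1.tendsto m
    have t2 := c2.tendsto m
    rw [e1] at t1
    rw [e2] at t2
    exact (t1.eventually_const_lt (by norm_num)).and (t2.eventually_const_lt (by norm_num))
  -- The third vertices lie on opposite sides of the edge: otherwise a point just off `m` towards
  -- `d` would be in both elements, with weight ε > 0 at `d`, which is no vertex of `K`.
  have hsign : cross (a - c) (b - c) * cross (a - d) (b - d) < 0 := by
    by_contra! hnn
    have hpos : 0 < cross (a - d) (b - d) / cross (a - c) (b - c) := by
      have : 0 < cross (a - c) (b - c) * cross (a - d) (b - d) :=
        lt_of_le_of_ne hnn (mul_ne_zero hc hd).symm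
      rcases pos_and_pos_or_neg_and_neg_of_mul_pos this with ⟨h1, h2⟩ | ⟨h1, h2⟩
      · exact div_pos h2 h1
      · exact div_pos_of_neg_of_neg h2 h1
    have hcont : Filter.Tendsto (fun ε : ℝ => m + ε • (d - m)) (nhdsWithin 0 (Ioi 0))
        (nhds m) := by
      have : Continuous fun ε : ℝ => m + ε • (d - m) := by fun_prop
      have h0 := this.tendsto 0
      simp only [zero_smul, add_zero] at h0
      exact h0.mono_left nhdsWithin_le_nhds
    obtain ⟨ε, ⟨⟨h1, h2⟩, hε⟩, hε1⟩ := (((hcont.eventually (hbary c hc)).and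
      self_mem_nhdsWithin).and (mem_nhdsWithin_of_mem_nhds
        (Iio_mem_nhds (show (0 : ℝ) < 1 by norm_num)))).exists
    have hε : 0 < ε := hε
    have hε1 : ε < 1 := hε1
    have hyK : m + ε • (d - m) ∈ convexHull ℝ (K.1 : Set Plane) := by
      refine mem_convexHull_of_cross hKc hc h1.le h2.le ?_
      have : cross (a - (m + ε • (d - m))) (b - (m + ε • (d - m))) =
          ε * cross (a - d) (b - d) := by
        simp only [hm, cross, PiLp.sub_apply, PiLp.add_apply, PiLp.smul_apply, smul_eq_mul]; ring
      rw [this, mul_div_assoc]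
      positivity
    obtain ⟨w, hw⟩ := mem_convexHull_iff_exists_isWeight.1 hyK
    have hLs : L.1 = {a, b, d} := by ext z; simp [hLd]
    have H := isWeight_tripleWeight hd (α := (1 - ε) / 2) (β := (1 - ε) / 2) (γ := ε)
      (by linarith) (by linarith) hε.le (by ring)
    have hx : ((1 - ε) / 2) • a + ((1 - ε) / 2) • b + ε • d = m + ε • (d - m) := by
      rw [hm]; module
    rw [hx, ← hLs] at H
    have hwd := congrFun (hM.weight_eq K hK L hL _ _ _ hw H) d
    rw [(tripleWeight_values hd _ _ _).2.2] at hwd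
    obtain ⟨-, d2, d3⟩ := cross_ne_zero_distinct hd
    have hdK : d ∉ K.1 := fun hdK => by
      rcases (h d).1 ⟨hdK, (hLd d).2 (.inr (.inr rfl))⟩ with h | h
      · exact d2 h.symm
      · exact d3 h.symm
    rw [hw.eq_zero d hdK] at hwd
    exact hε.ne hwd
  rw [← hΩ, mem_interior_iff_mem_nhds]
  filter_upwards [hbary c hc, hbary d hd] with y hyc hyd
  rw [← hM.iUnion_eq]
  simp only [mem_iUnion, exists_prop]
  by_cases hN : 0 ≤ cross (a - y) (b - y) / cross (a - c) (b - c)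
  · exact ⟨K, hK, mem_convexHull_of_cross hKc hc hyc.1.le hyc.2.le hN⟩
  · refine ⟨L, hL, mem_convexHull_of_cross hLd hd hyd.1.le hyd.2.le ?_⟩
    push Not at hN
    rcases mul_neg_iff.1 hsign with ⟨h1, h2⟩ | ⟨h1, h2⟩
    · have : cross (a - y) (b - y) < 0 := by
        by_contra! hc; exact absurd hN (not_lt.2 (div_nonneg hc h1.le))
      exact div_nonneg_of_nonpos this.le h2.le
    · have : 0 < cross (a - y) (b - y) := by
        by_contra! hc; exact absurd hN (not_lt.2 (div_nonneg_of_nonpos hc h1.le))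
      exact div_nonneg this.le h2.le

theorem IsMarkedTriangulation.mem_boundaryEdges_of_midpoint (hM : IsMarkedTriangulation Ω σ M)
    (hΩ : interior (closure Ω) = Ω) {K : MarkedTriangle} (hK : K ∈ M) {E : Finset Plane}
    (hEK : E ⊆ K.1) (hE2 : E.card = 2) (hm : edgeMidpoint E ∈ frontier Ω) :
    E ∈ boundaryEdges (elements M) := by
  classical
  refine mem_boundaryEdges.2 ⟨⟨K, hK, hEK, hE2⟩, fun K hK L hL hKL => ?_⟩
  obtain ⟨a, b, hab, rfl⟩ := Finset.card_eq_two.1 hE2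
  have hE : ({a, b} : Finset Plane) = {a, b} := rfl
  have := hM.midpoint_mem hΩ hK hL hab fun z => by
    rw [← Finset.mem_inter, hKL]; simp
  rw [edgeMidpoint_pair hab] at hm
  have ho : IsOpen Ω := hΩ ▸ isOpen_interior
  rw [ho.frontier_eq] at hm
  exact hm.2 this

end Mesh

/-! ### New nodes and boundary edges after a refinement step. -/

section Refine

variable {Ω : Set Plane} {σ : ℝ} {M M' : MarkedMesh} {F : Finset (Finset Plane)}

theorem subset_of_mem_bisectIf {K K' : MarkedTriangle} (hK : IsShapeRegular σ K)
    (hK' : K' ∈ bisectIf F K) :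
    K'.2 ⊆ K.1 ∧ ∀ z ∈ K'.1, z ∈ K.1 ∨ K.2 ∈ F ∧ z = edgeMidpoint K.2 := by
  classical
  unfold bisectIf at hK'
  split_ifs at hK' with hF
  · obtain ⟨p, q, c, rfl, h, hσ, rfl⟩ := exists_of_mem_bisect hK hK'
    have := edgeMidpoint_pair (cross_ne_zero_distinct h).1
    refine ⟨fun z hz => ?_, fun z hz => ?_⟩
    · simp only [Finset.mem_insert, Finset.mem_singleton] at hz ⊢
      tauto
    · simp only [Finset.mem_insert, Finset.mem_singleton] at hz ⊢
      rw [this]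
      tauto
  · rw [Finset.mem_singleton.1 hK']
    exact ⟨hK.ref_subset, fun z hz => .inl hz⟩

theorem mem_or_eq_midpoint_of_mem_refineElement {K K'' : MarkedTriangle}
    (hK : IsShapeRegular σ K) (hK'' : K'' ∈ refineElement F K) {z : Plane} (hz : z ∈ K''.1) :
    z ∈ K.1 ∨ ∃ E ∈ F, E ⊆ K.1 ∧ E.card = 2 ∧ z = edgeMidpoint E := by
  obtain ⟨K', hK', hK''⟩ := mem_refineElement.1 hK''
  obtain ⟨h1, h2⟩ := subset_of_mem_bisectIf hK hK'
  obtain ⟨-, h3⟩ := subset_of_mem_bisectIf (hK.bisectIf hK') hK''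
  rcases h3 z hz with h | ⟨h, rfl⟩
  · rcases h2 z h with h' | ⟨h', rfl⟩
    · exact .inl h'
    · exact .inr ⟨_, h', hK.ref_subset, hK.ref_card, rfl⟩
  · exact .inr ⟨_, h, h1, (hK.bisectIf hK').ref_card, rfl⟩

/-- A boundary edge is either kept or halved by a refinement step. -/
theorem IsMarkedTriangulation.boundaryEdges_step (hM : IsMarkedTriangulation Ω σ M)
    (hΩ : interior (closure Ω) = Ω) (hF : ∀ K ∈ M, ∀ E ∈ F, E ⊆ K.1 → K.2 ∈ F)
    (hM' : ∀ K'', K'' ∈ M' ↔ ∃ K ∈ M, K'' ∈ refineElement F K) {a b : Plane} (hab : a ≠ b)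
    {E : Finset Plane} (hE : ∀ z, z ∈ E ↔ z = a ∨ z = b)
    (hEb : E ∈ boundaryEdges (elements M)) :
    (E ∉ F → E ∈ boundaryEdges (elements M')) ∧
    (E ∈ F → ∃ E' ∈ boundaryEdges (elements M'),
      ∀ z, z ∈ E' ↔ z = a ∨ z = (1 / 2 : ℝ) • (a + b)) := by
  classical
  have hMM' := hM.step hF hM'
  have ho : IsOpen Ω := hΩ ▸ isOpen_interior
  have hsub := hM.segment_subset_frontier ho hEb hab hE
  obtain ⟨⟨K, hK, hEK, hE2⟩, -⟩ := mem_boundaryEdges.1 hEb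
  have haK := hEK ((hE a).2 (.inl rfl))
  have hbK := hEK ((hE b).2 (.inr rfl))
  have hEab : E = {a, b} := by ext z; simp [hE]
  -- This point is the midpoint of the half next to `a`. In the son containing it, the positive
  -- weights reveal the vertices: `a, b` if the edge is kept, `a, m` if it is halved.
  set x : Plane := (3 / 4 : ℝ) • a + (1 / 4 : ℝ) • b with hx
  set w : Plane → ℝ := fun z => (3 / 4 : ℝ) * (if z = a then 1 else 0) +
    (1 / 4 : ℝ) * (if z = b then 1 else 0) with hw
  have wa : w a = 3 / 4 := by simp [hw, hab]
  have wb : w b = 1 / 4 := by simp [hw, hab.symm]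
  have hxK : IsWeight K.1 x w := isWeight_pair haK hbK (by norm_num) (by norm_num) (by norm_num)
  obtain ⟨K₁, hK₁, w₁, hw₁⟩ := refineElement_exists_mem (F := F) (hM.shape K hK) hxK
  have hK₁M : K₁ ∈ M' := (hM' _).2 ⟨K, hK, hK₁⟩
  obtain ⟨v, hv, hv1, -⟩ := exists_weight_of_mem_refineElement (hM.shape K hK) (hF K hK) hK₁ hw₁
  obtain rfl := (hM.shape K hK).weight_unique hv hxK
  have hwE : ∀ z, z ∉ E → w z = 0 := fun z hz => by
    rw [hE, not_or] at hz
    simp [hw, hz.1, hz.2]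
  have hwf := hv1 E hEK hE2 hwE
  have hmem : ∀ z, 0 < w₁ z → z ∈ K₁.1 := fun z hz => by
    by_contra h
    exact hz.ne' (hw₁.eq_zero z h)
  constructor
  · intro hEF
    have hww : w₁ = w := by rw [hwf, bisectWeightIf, if_neg hEF]
    refine hMM'.mem_boundaryEdges_of_midpoint hΩ hK₁M (fun z hz => hmem z ?_) hE2 (hsub ?_)
    · rcases (hE z).1 hz with rfl | rfl
      · rw [hww, wa]; norm_num
      · rw [hww, wb]; norm_num
    · rw [hEab, edgeMidpoint_pair hab]
      exact ⟨1 / 2, 1 / 2, by norm_num, by norm_num, by norm_num, by rw [smul_add]⟩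
  · intro hEF
    set m : Plane := (1 / 2 : ℝ) • (a + b) with hm
    have hma : a ≠ m := fun h => hab <| by
      have := congrArg (fun z => (2 : ℝ) • z) h
      simp only [hm, smul_smul] at this
      norm_num [two_smul] at this
      exact this
    have hmb : b ≠ m := fun h => hab <| by
      have := congrArg (fun z => (2 : ℝ) • z) h
      simp only [hm, smul_smul] at this
      norm_num [two_smul] at this
      exact this.symm
    have hmin : minWeight E w = 1 / 4 := by
      rw [hEab, minWeight_pair, wa, wb]; norm_num
    have hmid : edgeMidpoint E = m := by rw [hEab, edgeMidpoint_pair hab]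
    have hww : ∀ z, w₁ z = w z - (if z ∈ E then 1 / 4 else 0) + if z = m then 1 / 2 else 0 := by
      intro z
      rw [hwf, bisectWeightIf, if_pos hEF, bisectWeight, hmin, hmid]
      norm_num
    have hmE : m ∉ E := by rw [hE]; tauto
    refine ⟨{a, m}, hMM'.mem_boundaryEdges_of_midpoint hΩ hK₁M (fun z hz => hmem z ?_)
      (Finset.card_pair hma) (hsub ?_), fun z => by simp⟩
    · simp only [Finset.mem_insert, Finset.mem_singleton] at hz
      rcases hz with rfl | rfl
      · rw [hww, wa, if_pos ((hE _).2 (.inl rfl)), if_neg hma]; norm_num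
      · rw [hww, hwE _ hmE, if_neg hmE, if_pos rfl]; norm_num
    · rw [edgeMidpoint_pair hma]
      refine ⟨3 / 4, 1 / 4, by norm_num, by norm_num, by norm_num, ?_⟩
      rw [hm]; module

end Refine

/-! ### Integrals along a boundary edge -/

theorem lineDeriv_of_eqOn_segment {d : Plane → ℝ} {A : Plane →ᵃ[ℝ] ℝ} {p q x : Plane}
    (h : EqOn d A (segment ℝ p q)) (hx : x ∈ openSegment ℝ p q) (r : ℝ) :
    lineDeriv ℝ d x (r • (q - p)) = r * (d q - d p) := by
  obtain ⟨α, β, hα, hβ, hs, rfl⟩ := hx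
  have hA : A.linear (q - p) = d q - d p := by
    rw [h (right_mem_segment ℝ p q), h (left_mem_segment ℝ p q), ← vsub_eq_sub, A.linearMap_vsub,
      vsub_eq_sub]
  have hev : (fun t : ℝ => d ((α • p + β • q) + t • r • (q - p))) =ᶠ[nhds 0]
      fun t => A (α • p + β • q) + t * (r * (d q - d p)) := by
    have c1 : ∀ᶠ t in nhds (0 : ℝ), 0 < α - t * r := by
      have : Continuous fun t : ℝ => α - t * r := by fun_prop
      exact this.tendsto 0 |>.eventually_const_lt (by simpa using hα)
    have c2 : ∀ᶠ t in nhds (0 : ℝ), 0 < β + t * r := by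
      have : Continuous fun t : ℝ => β + t * r := by fun_prop
      exact this.tendsto 0 |>.eventually_const_lt (by simpa using hβ)
    filter_upwards [c1, c2] with t h1 h2
    have hmem : (α • p + β • q) + t • r • (q - p) ∈ segment ℝ p q :=
      ⟨α - t * r, β + t * r, h1.le, h2.le, by linarith, by module⟩
    rw [h hmem, add_comm, ← vadd_eq_add (t • r • (q - p)), A.map_vadd, map_smul, map_smul, hA]
    simp only [smul_eq_mul, vadd_eq_add]
    ring
  rw [lineDeriv, hev.deriv_eq]
  simp

open Classical in
theorem unitTangent_pair {a b : Plane} (hab : a ≠ b) :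
    ∃ r : ℝ, unitTangent {a, b} = r • (b - a) ∧ |r| * ‖b - a‖ = 1 := by
  have hpos : 0 < ‖b - a‖ := norm_pos_iff.2 (sub_ne_zero.2 hab.symm)
  have hex : ∃ τ ∈ vectorSpan ℝ ((({a, b} : Finset Plane)) : Set Plane), ‖τ‖ = 1 := by
    refine ⟨‖b - a‖⁻¹ • (b - a), ?_, ?_⟩
    · refine Submodule.smul_mem _ _ (vsub_mem_vectorSpan ℝ ?_ ?_) <;> simp
    · rw [norm_smul, norm_inv, norm_norm, inv_mul_cancel₀ hpos.ne']
  rw [unitTangent, dif_pos hex]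
  obtain ⟨h1, h2⟩ := hex.choose_spec
  set τ := hex.choose
  rw [Finset.coe_pair, pair_comm, mem_vectorSpan_pair] at h1
  obtain ⟨r, hr⟩ := h1
  rw [vsub_eq_sub] at hr
  refine ⟨r, hr.symm, ?_⟩
  rw [← h2, ← hr, norm_smul, Real.norm_eq_abs]

theorem mem_openSegment_half {a b x : Plane} (hx : x ∈ segment ℝ a b) (ha : x ≠ a) (hb : x ≠ b)
    (hm : x ≠ (1 / 2 : ℝ) • (a + b)) : x ∈ openSegment ℝ a ((1 / 2 : ℝ) • (a + b)) ∨
      x ∈ openSegment ℝ ((1 / 2 : ℝ) • (a + b)) b := by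
  obtain ⟨α, β, hα, hβ, hs, rfl⟩ := hx
  have hα0 : α ≠ 0 := by
    rintro rfl
    exact hb (by rw [zero_add] at hs; simp [hs])
  have hβ0 : β ≠ 0 := by
    rintro rfl
    exact ha (by rw [add_zero] at hs; simp [hs])
  have hα' := lt_of_le_of_ne hα hα0.symm
  have hβ' := lt_of_le_of_ne hβ hβ0.symm
  rcases lt_trichotomy α β with h | h | h
  · right
    refine ⟨2 * α, β - α, by linarith, by linarith, by linarith, by module⟩
  · exfalso
    apply hm
    obtain rfl : α = 1 / 2 := by linarith
    rw [← h, smul_add]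
  · left
    refine ⟨α - β, 2 * β, by linarith, by linarith, by linarith, by module⟩

theorem measurableSet_segment (a b : Plane) : MeasurableSet (segment ℝ a b) := by
  rw [← convexHull_pair]
  exact ((Set.toFinite _).isClosed_convexHull ℝ).measurableSet

theorem measurableSet_openSegment (p q : Plane) : MeasurableSet (openSegment ℝ p q) := by
  by_cases hpq : p = q
  · rw [hpq, openSegment_same]
    exact measurableSet_singleton q
  have : openSegment ℝ p q = segment ℝ p q \ {p, q} := by
    rw [← insert_endpoints_openSegment]
    ext z
    simp only [mem_sdiff, mem_insert_iff, mem_singleton_iff, not_or]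
    constructor
    · intro hz
      refine ⟨.inr (.inr hz), ?_, ?_⟩
      · rintro rfl; exact hpq (left_mem_openSegment_iff.1 hz)
      · rintro rfl; exact hpq (right_mem_openSegment_iff.1 hz)
    · rintro ⟨h | h | h, h1, h2⟩
      exacts [absurd h h1, absurd h h2, h]
  rw [this]
  exact (measurableSet_segment _ _).diff (Set.toFinite _).measurableSet

theorem eLpNorm_const_sq (μ : Measure Plane) (c : ℝ) :
    eLpNorm (fun _ : Plane => c) 2 μ ^ 2 = ENNReal.ofReal (c ^ 2) * μ univ := by
  rw [eLpNorm_const' _ (by norm_num) (by norm_num), mul_pow, ← ENNReal.rpow_natCast (_ ^ _),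
    ← ENNReal.rpow_mul, ← ofReal_norm, ← ENNReal.ofReal_pow (norm_nonneg _), Real.norm_eq_abs,
    sq_abs]
  have : 1 / (2 : ℝ≥0∞).toReal * ((2 : ℕ) : ℝ) = 1 := by norm_num
  rw [this, ENNReal.rpow_one]

theorem ae_ne_arclength (Γ : Set Plane) (z : Plane) : ∀ᵐ x ∂(arclength Γ), x ≠ z := by
  have : NullSingletonClass (Measure.hausdorffMeasure 1 : Measure Plane) :=
    Measure.nullSingletonClass_hausdorff Plane one_pos
  refine ae_restrict_of_ae ?_
  rw [ae_iff]
  simp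

section Edge

variable {d : Plane → ℝ} {A₁ A₂ : Plane →ᵃ[ℝ] ℝ} {a b : Plane}

-- Here `d` is a hat on an edge of length h: its derivative is ±2 d(m)/h off the three null points
-- `a`, `m`, `b`, and h · h · (2 d(m)/h)² = 4 d(m)².
open Classical in
theorem diam_mul_eLpNorm_arcDeriv (hab : a ≠ b)
    (h1 : EqOn d A₁ (segment ℝ a ((1 / 2 : ℝ) • (a + b))))
    (h2 : EqOn d A₂ (segment ℝ ((1 / 2 : ℝ) • (a + b)) b)) (ha : d a = 0) (hb : d b = 0) :
    ENNReal.ofReal (Metric.diam (convexHull ℝ (({a, b} : Finset Plane) : Set Plane))) *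
      eLpNorm (arcDeriv {a, b} d) 2
        (arclength (convexHull ℝ (({a, b} : Finset Plane) : Set Plane))) ^ 2 =
      ENNReal.ofReal (4 * d ((1 / 2 : ℝ) • (a + b)) ^ 2) := by
  set m : Plane := (1 / 2 : ℝ) • (a + b) with hm
  obtain ⟨r, hr, hr1⟩ := unitTangent_pair hab
  have hpos : 0 < ‖b - a‖ := norm_pos_iff.2 (sub_ne_zero.2 hab.symm)
  rw [convexHull_diam, Finset.coe_pair, convexHull_pair, Metric.diam_pair]
  have hae : ∀ᵐ x ∂(arclength (segment ℝ a b)), ‖arcDeriv {a, b} d x‖ = ‖2 * r * d m‖ := by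
    filter_upwards [ae_ne_arclength _ a, ae_ne_arclength _ b, ae_ne_arclength _ m,
      ae_restrict_mem (measurableSet_segment a b)]
      with x xa xb xm hx
    rw [arcDeriv, hr]
    rcases mem_openSegment_half hx xa xb xm with hx | hx
    · have : r • (b - a) = (2 * r) • (m - a) := by rw [hm]; module
      rw [this, lineDeriv_of_eqOn_segment h1 hx, ha, sub_zero]
    · have : r • (b - a) = (2 * r) • (b - m) := by rw [hm]; module
      rw [this, lineDeriv_of_eqOn_segment h2 hx, hb, zero_sub, mul_neg, norm_neg]
  rw [eLpNorm_congr_norm_ae (g := fun _ => 2 * r * d m) hae, eLpNorm_const_sq, arclength,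
    Measure.restrict_apply_univ, hausdorffMeasure_segment, edist_dist,
    ← ENNReal.ofReal_mul (by positivity), ← ENNReal.ofReal_mul (by positivity)]
  congr 1
  rw [dist_comm, dist_eq_norm]
  calc ‖b - a‖ * ((2 * r * d m) ^ 2 * ‖b - a‖) = 4 * (|r| * ‖b - a‖) ^ 2 * d m ^ 2 := by
        rw [mul_pow |r|, sq_abs]; ring
    _ = _ := by rw [hr1]; ring

/-- Along the segment the difference quotient has constant modulus |d(q)|/|q - p| off the diagonal,
and each integration contributes a factor |q - p|. -/
theorem le_lintegral_openSegment {p q : Plane} (hpq : p ≠ q) (h : EqOn d A₁ (segment ℝ p q))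
    (hp : d p = 0) : ENNReal.ofReal (d q ^ 2) ≤
      ∫⁻ x, ∫⁻ y, edist (d x) (d y) ^ 2 / edist x y ^ 2
        ∂(arclength (openSegment ℝ p q)) ∂(arclength (openSegment ℝ p q)) := by
  have hpos : 0 < ‖q - p‖ := norm_pos_iff.2 (sub_ne_zero.2 hpq.symm)
  set S := openSegment ℝ p q with hS
  have hSm : MeasurableSet S := measurableSet_openSegment p q
  have hvol : arclength S univ = ENNReal.ofReal ‖q - p‖ := by
    have hN : NullSingletonClass (Measure.hausdorffMeasure 1 : Measure Plane) :=
      Measure.nullSingletonClass_hausdorff Plane one_pos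
    rw [arclength, Measure.restrict_apply_univ, ← dist_eq_norm, dist_comm, ← edist_dist,
      ← hausdorffMeasure_segment, ← insert_endpoints_openSegment,
      measure_congr (insert_ae_eq_self _ _), measure_congr (insert_ae_eq_self _ _)]
  set k : ℝ≥0∞ := ENNReal.ofReal ((|d q| / ‖q - p‖) ^ 2) with hk
  have hquot : ∀ x ∈ S, ∀ y ∈ S, y ≠ x → edist (d x) (d y) ^ 2 / edist x y ^ 2 = k := by
    rintro x ⟨α, β, hα, hβ, hs, rfl⟩ y ⟨α', β', hα', hβ', hs', rfl⟩ hne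
    have hval : ∀ u v : ℝ, 0 < u → 0 < v → u + v = 1 → d (u • p + v • q) = v * d q := by
      intro u v hu hv huv
      have h0 : A₁ p = 0 := by rw [← h (left_mem_segment ℝ p q), hp]
      rw [h ⟨u, v, hu.le, hv.le, huv, rfl⟩, Convex.combo_affine_apply huv, h0,
        ← h (right_mem_segment ℝ p q)]
      simp
    have hββ : 0 < |β - β'| := by
      rw [abs_pos, sub_ne_zero]
      rintro rfl
      apply hne
      have : α = α' := by linarith
      rw [this]
    have e1 : dist (d (α • p + β • q)) (d (α' • p + β' • q)) = |β - β'| * |d q| := by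
      rw [hval α β hα hβ hs, hval α' β' hα' hβ' hs', Real.dist_eq, ← sub_mul, abs_mul]
    have e2 : dist (α • p + β • q) (α' • p + β' • q) = |β - β'| * ‖q - p‖ := by
      rw [dist_eq_norm, ← Real.norm_eq_abs, ← norm_smul]
      congr 1
      obtain rfl : α = 1 - β := by linarith
      obtain rfl : α' = 1 - β' := by linarith
      module
    rw [edist_dist, edist_dist, e1, e2, ← ENNReal.ofReal_pow (by positivity),
      ← ENNReal.ofReal_pow (by positivity), ← ENNReal.ofReal_div_of_pos (by positivity), hk,
      ← div_pow, mul_div_mul_left _ _ hββ.ne']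
  have inner : ∀ x ∈ S, ∫⁻ y, edist (d x) (d y) ^ 2 / edist x y ^ 2 ∂(arclength S) =
      k * ENNReal.ofReal ‖q - p‖ := by
    intro x hx
    rw [← hvol, ← lintegral_const]
    refine lintegral_congr_ae ?_
    filter_upwards [ae_ne_arclength S x, ae_restrict_mem hSm] with y hyx hy
    exact hquot x hx y hy hyx
  have outer : ∫⁻ x, ∫⁻ y, edist (d x) (d y) ^ 2 / edist x y ^ 2 ∂(arclength S) ∂(arclength S) =
      k * ENNReal.ofReal ‖q - p‖ * ENNReal.ofReal ‖q - p‖ := by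
    rw [← (lintegral_const (k * ENNReal.ofReal ‖q - p‖)).trans (congrArg _ hvol)]
    refine lintegral_congr_ae ?_
    filter_upwards [ae_restrict_mem hSm] with x hx
    exact inner x hx
  rw [outer, hk, ← ENNReal.ofReal_mul (by positivity), ← ENNReal.ofReal_mul (by positivity)]
  apply ENNReal.ofReal_le_ofReal
  rw [div_pow, sq_abs]
  field_simp
  exact le_rfl

end Edge

/-- All terms are nonnegative: the L² part and the pairs of points not in a common piece are
dropped. -/
theorem sum_lintegral_le_hHalfNorm {ι : Type*} {I : Finset ι} {S : ι → Set Plane} {Γ : Set Plane}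
    (hS : ∀ i ∈ I, S i ⊆ Γ) (hSm : ∀ i ∈ I, MeasurableSet (S i))
    (hdisj : (I : Set ι).PairwiseDisjoint S) (v : Plane → ℝ) :
    ∑ i ∈ I, ∫⁻ x, ∫⁻ y, edist (v x) (v y) ^ 2 / edist x y ^ 2
      ∂(arclength (S i)) ∂(arclength (S i)) ≤ hHalfNorm Γ v ^ 2 := by
  have h2 : hHalfNorm Γ v ^ 2 = eLpNorm v 2 (arclength Γ) ^ 2 +
      ∫⁻ x, ∫⁻ y, edist (v x) (v y) ^ 2 / edist x y ^ 2 ∂(arclength Γ) ∂(arclength Γ) := by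
    rw [hHalfNorm, ← ENNReal.rpow_natCast, ← ENNReal.rpow_mul]
    norm_num
  rw [h2]
  refine le_trans ?_ le_add_self
  have hsub : ⋃ i ∈ I, S i ⊆ Γ := iUnion₂_subset hS
  calc _ ≤ ∑ i ∈ I, ∫⁻ x in S i, ∫⁻ y, edist (v x) (v y) ^ 2 / edist x y ^ 2
        ∂(arclength Γ) ∂(Measure.hausdorffMeasure 1) := by
        refine Finset.sum_le_sum fun i hi => lintegral_mono fun x => ?_
        exact lintegral_mono' (Measure.restrict_mono (hS i hi) le_rfl) le_rfl
    _ = ∫⁻ x in ⋃ i ∈ I, S i, ∫⁻ y, edist (v x) (v y) ^ 2 / edist x y ^ 2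
        ∂(arclength Γ) ∂(Measure.hausdorffMeasure 1) :=
        (lintegral_biUnion_finset hdisj hSm _).symm
    _ ≤ _ := lintegral_mono' (Measure.restrict_mono hsub le_rfl) le_rfl

/-! ### Pointwise Lipschitz functions -/

/-- A mean value inequality along the segment from `x` to `y`: the local slopes are at most `L * ‖y
- x‖`, and ε supplies the strict inequality required of the comparison function. -/
theorem lipschitzWith_of_eventually {f : Plane → ℝ} {L : ℝ≥0}
    (h : ∀ x, ∀ᶠ y in nhds x, |f y - f x| ≤ L * ‖y - x‖) : LipschitzWith L f := by
  have hcont : Continuous f := by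
    rw [continuous_iff_continuousAt]
    intro x
    rw [ContinuousAt, tendsto_iff_norm_sub_tendsto_zero]
    refine squeeze_zero' (Filter.Eventually.of_forall fun y => norm_nonneg _) (h x) ?_
    have : Continuous fun y : Plane => (L : ℝ) * ‖y - x‖ := by fun_prop
    simpa using this.tendsto x
  refine LipschitzWith.of_dist_le_mul fun y x => ?_
  rw [Real.dist_eq, dist_eq_norm]
  refine le_of_forall_pos_le_add fun ε hε => ?_
  set φ : ℝ → ℝ := fun s => f (x + s • (y - x)) - f x with hφ
  have hφc : Continuous φ := by fun_prop
  have key := image_norm_le_of_liminf_right_slope_norm_lt_deriv_boundary (a := 0) (b := 1)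
    (f := φ) (f' := fun _ => L * ‖y - x‖) hφc.continuousOn ?_
    (B := fun s => (L * ‖y - x‖ + ε) * s) (B' := fun _ => L * ‖y - x‖ + ε) (by simp [hφ])
    (by fun_prop) (fun s _ => ?_) (fun s _ _ => by linarith) (right_mem_Icc.2 zero_le_one)
  · simpa [hφ] using key
  · intro s _ r hr
    have hline : Continuous fun z : ℝ => x + z • (y - x) := by fun_prop
    have hev := (hline.tendsto s).eventually (h (x + s • (y - x)))
    refine Filter.Eventually.frequently ?_
    filter_upwards [mem_nhdsWithin_of_mem_nhds hev, self_mem_nhdsWithin] with z hz hsz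
    have hsz : s < z := hsz
    have hpos : 0 < z - s := sub_pos.2 hsz
    refine lt_of_le_of_lt ?_ hr
    rw [slope_def_field, div_le_iff₀ hpos]
    have e1 : x + z • (y - x) - (x + s • (y - x)) = (z - s) • (y - x) := by module
    rw [e1, norm_smul, Real.norm_of_nonneg hpos.le] at hz
    calc (norm ∘ φ) z - (norm ∘ φ) s ≤ ‖φ z - φ s‖ := norm_sub_norm_le _ _
      _ = |f (x + z • (y - x)) - f (x + s • (y - x))| := by
        rw [Real.norm_eq_abs]; congr 1; simp only [hφ]; ring
      _ ≤ _ := hz.trans (le_of_eq (by ring))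
  · have := ((hasDerivAt_id s).const_mul (L * ‖y - x‖ + ε)).hasDerivWithinAt (s := Ici s)
    simpa using this

/-- Integration by parts against the constant function 1. -/
theorem integral_lineDeriv_eq_zero {f : Plane → ℝ} {L : ℝ≥0} (hf : LipschitzWith L f)
    (hc : HasCompactSupport f) (e : Plane) : ∫ x, lineDeriv ℝ f x e = 0 := by
  have h := LipschitzWith.integral_lineDeriv_mul_eq (μ := (volume : Measure Plane))
    (LipschitzWith.const (1 : ℝ)) hf hc (-e)
  simp only [neg_neg, mul_one] at h
  rw [← h]
  have : ∀ x, lineDeriv ℝ (fun _ : Plane => (1 : ℝ)) x (-e) = 0 := fun x => by simp [lineDeriv]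
  simp [this]

/-! ### The weak gradient of a continuous, piecewise affine function -/

/-- The gradient of an affine function. -/
noncomputable def affineGradient (A : Plane →ᵃ[ℝ] ℝ) : Plane :=
  (InnerProductSpace.toDual ℝ Plane).symm (LinearMap.toContinuousLinearMap A.linear)

theorem inner_affineGradient (A : Plane →ᵃ[ℝ] ℝ) (v : Plane) :
    inner ℝ (affineGradient A) v = A.linear v := by
  simp [affineGradient]

theorem sub_eq_inner_affineGradient (A : Plane →ᵃ[ℝ] ℝ) (x y : Plane) :
    A y - A x = inner ℝ (affineGradient A) (y - x) := by
  rw [inner_affineGradient, ← vsub_eq_sub, ← A.linearMap_vsub, vsub_eq_sub]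

theorem hasGradientAt_of_eqOn {D : Plane → ℝ} {A : Plane →ᵃ[ℝ] ℝ} {s : Set Plane} {x : Plane}
    (h : EqOn D A s) (hx : x ∈ interior s) : HasGradientAt D (affineGradient A) x := by
  have hA : HasFDerivAt A (LinearMap.toContinuousLinearMap A.linear) x := by
    have : (A : Plane → ℝ) = fun y => LinearMap.toContinuousLinearMap A.linear y + A 0 := by
      funext y
      have := A.map_vadd 0 y
      simpa using this
    rw [this]
    exact (ContinuousLinearMap.hasFDerivAt _).add_const _
  rw [hasGradientAt_iff_hasFDerivAt, affineGradient, LinearIsometryEquiv.apply_symm_apply]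
  exact hA.congr_of_eventuallyEq (h.eventuallyEq_of_mem (mem_interior_iff_mem_nhds.1 hx))

/-- A function which is continuous on `closure Ω` and affine on each of the convex sets `P i`. -/
structure IsPiecewiseAffine {ι : Type*} [Fintype ι] (Ω : Set Plane) (P : ι → Set Plane)
    (A : ι → Plane →ᵃ[ℝ] ℝ) (D : Plane → ℝ) : Prop where
  isOpen : IsOpen Ω
  isBounded : Bornology.IsBounded Ω
  isClosed : ∀ i, IsClosed (P i)
  convex : ∀ i, Convex ℝ (P i)
  subset : Ω ⊆ ⋃ i, P i
  continuousOn : ContinuousOn D (closure Ω)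
  eqOn : ∀ i, EqOn D (A i) (P i)

section PiecewiseAffine

variable {ι : Type*} [Fintype ι] {Ω : Set Plane} {P : ι → Set Plane} {A : ι → Plane →ᵃ[ℝ] ℝ}
  {D : Plane → ℝ}

/-- The boundary of a convex set is a null set. -/
theorem IsPiecewiseAffine.ae_mem_interior (h : IsPiecewiseAffine Ω P A D) :
    ∀ᵐ x ∂(volume.restrict Ω), ∃ i, x ∈ interior (P i) := by
  have h1 : ∀ᵐ x : Plane, ∀ i, x ∉ frontier (P i) := by
    rw [ae_all_iff]
    intro i
    exact measure_eq_zero_iff_ae_notMem.1 ((h.convex i).addHaar_frontier volume)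
  filter_upwards [ae_restrict_of_ae h1, ae_restrict_mem h.isOpen.measurableSet] with x hx hxΩ
  obtain ⟨i, hi⟩ := mem_iUnion.1 (h.subset hxΩ)
  refine ⟨i, ?_⟩
  by_contra hn
  exact hx i (by rw [frontier, (h.isClosed i).closure_eq]; exact ⟨hi, hn⟩)

theorem measurable_gradient (D : Plane → ℝ) : Measurable (gradient D) :=
  (InnerProductSpace.toDual ℝ Plane).symm.continuous.measurable.comp (measurable_fderiv ℝ D)

/-- Values of `D` outside the closure of Ω are arbitrary, but the product with a test function
vanishes there, so a local bound at every point of the plane suffices. -/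
theorem IsPiecewiseAffine.exists_lipschitz (h : IsPiecewiseAffine Ω P A D) {φ : Plane → ℝ}
    (hφ : ContDiff ℝ ∞ φ) (hc : HasCompactSupport φ) (hs : tsupport φ ⊆ Ω) :
    ∃ L : ℝ≥0, LipschitzWith L fun x => D x * φ x := by
  obtain ⟨B, hB⟩ := h.isBounded.isCompact_closure.exists_bound_of_continuousOn h.continuousOn
  obtain ⟨Bφ, hBφ⟩ := hc.exists_bound_of_continuous hφ.continuous
  obtain ⟨Lφ, hLφ⟩ := ContDiff.lipschitzWith_of_hasCompactSupport hc hφ (by simp)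
  set Γ : ℝ := ∑ i, ‖affineGradient (A i)‖ with hΓ
  have hΓi : ∀ i, ‖affineGradient (A i)‖ ≤ Γ := fun i =>
    Finset.single_le_sum (f := fun i => ‖affineGradient (A i)‖) (fun i _ => norm_nonneg _)
      (Finset.mem_univ i)
  have hΓ0 : 0 ≤ Γ := Finset.sum_nonneg fun i _ => norm_nonneg _
  have hBφ0 : 0 ≤ Bφ := (norm_nonneg _).trans (hBφ 0)
  refine ⟨Real.toNNReal (|B| * Lφ + Γ * Bφ), lipschitzWith_of_eventually fun x => ?_⟩
  rw [Real.coe_toNNReal _ (by positivity)]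
  by_cases hx : x ∈ Ω
  -- The pieces are finitely many and closed, so every piece meeting a small neighbourhood of `x`
  -- contains `x`. Then `D y - D x` is the increment of a single affine function.
  · have hev : ∀ᶠ y in nhds x, ∀ i, y ∈ P i → x ∈ P i := by
      rw [Filter.eventually_all]
      intro i
      by_cases hxi : x ∈ P i
      · exact Filter.Eventually.of_forall fun _ _ => hxi
      · filter_upwards [(h.isClosed i).isOpen_compl.mem_nhds hxi] with y hy hy'
        exact absurd hy' hy
    filter_upwards [hev, h.isOpen.mem_nhds hx] with y hy hyΩ
    obtain ⟨i, hi⟩ := mem_iUnion.1 (h.subset hyΩ)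
    have e1 : D y * φ y - D x * φ x = D y * (φ y - φ x) + (D y - D x) * φ x := by ring
    have e2 : |D y - D x| ≤ Γ * ‖y - x‖ := by
      rw [h.eqOn i hi, h.eqOn i (hy i hi), sub_eq_inner_affineGradient]
      exact (abs_real_inner_le_norm _ _).trans
        (mul_le_mul_of_nonneg_right (hΓi i) (norm_nonneg _))
    have e3 : |φ y - φ x| ≤ Lφ * ‖y - x‖ := by
      have := hLφ.dist_le_mul y x
      rwa [Real.dist_eq, dist_eq_norm] at this
    have e4 : |D y| ≤ |B| := (hB y (subset_closure hyΩ)).trans (le_abs_self B)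
    have e5 : |φ x| ≤ Bφ := hBφ x
    rw [e1]
    calc |D y * (φ y - φ x) + (D y - D x) * φ x| ≤
        |D y| * |φ y - φ x| + |D y - D x| * |φ x| := by
          rw [← abs_mul, ← abs_mul]; exact abs_add_le _ _
      _ ≤ |B| * (Lφ * ‖y - x‖) + (Γ * ‖y - x‖) * Bφ := by gcongr
      _ = _ := by ring
  · have hx' : x ∉ tsupport φ := fun hx' => hx (hs hx')
    filter_upwards [(isClosed_tsupport φ).isOpen_compl.mem_nhds hx'] with y hy
    rw [image_eq_zero_of_notMem_tsupport hx', image_eq_zero_of_notMem_tsupport hy]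
    simp only [mul_zero, sub_zero, abs_zero]
    positivity

/-- The product of `D` and a test function is Lipschitz with compact support, so its directional
derivative has integral zero; almost everywhere the product rule splits it into the two required
terms. -/
theorem IsPiecewiseAffine.isWeakGradient (h : IsPiecewiseAffine Ω P A D) :
    IsWeakGradient Ω D (gradient D) := by
  have hvol : volume Ω < ⊤ := h.isBounded.measure_lt_top
  have hfin : IsFiniteMeasure (volume.restrict Ω) := ⟨by simpa using hvol⟩
  have hDm : AEStronglyMeasurable D (volume.restrict Ω) :=
    (h.continuousOn.mono subset_closure).aestronglyMeasurable h.isOpen.measurableSet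
  have hGm : AEStronglyMeasurable (gradient D) (volume.restrict Ω) :=
    (measurable_gradient D).aestronglyMeasurable
  obtain ⟨B, hB⟩ := h.isBounded.isCompact_closure.exists_bound_of_continuousOn h.continuousOn
  have hDB : ∀ᵐ x ∂(volume.restrict Ω), ‖D x‖ ≤ B := by
    filter_upwards [ae_restrict_mem h.isOpen.measurableSet] with x hx
    exact hB x (subset_closure hx)
  have hGB : ∀ᵐ x ∂(volume.restrict Ω), ‖gradient D x‖ ≤ ∑ i, ‖affineGradient (A i)‖ := by
    filter_upwards [h.ae_mem_interior] with x ⟨i, hi⟩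
    rw [(hasGradientAt_of_eqOn (h.eqOn i) hi).gradient]
    exact Finset.single_le_sum (f := fun i => ‖affineGradient (A i)‖)
      (fun i _ => norm_nonneg _) (Finset.mem_univ i)
  have hDi : IntegrableOn D Ω := Integrable.of_bound hDm B hDB
  have hGi : IntegrableOn (gradient D) Ω := Integrable.of_bound hGm _ hGB
  refine ⟨hDi.locallyIntegrableOn, hGi.locallyIntegrableOn, fun φ hφ hc hs e => ?_⟩
  obtain ⟨L, hL⟩ := h.exists_lipschitz hφ hc hs
  have hzero := integral_lineDeriv_eq_zero hL (hc.mul_left (f := D)) e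
  rw [← setIntegral_eq_integral_of_forall_compl_eq_zero (s := Ω)] at hzero
  · have hae : ∀ᵐ x ∂(volume.restrict Ω), lineDeriv ℝ (fun x => D x * φ x) x e =
        D x * fderiv ℝ φ x e + inner ℝ (gradient D x) e * φ x := by
      filter_upwards [h.ae_mem_interior] with x ⟨i, hi⟩
      have hg := hasGradientAt_of_eqOn (h.eqOn i) hi
      have h1 := hg.hasFDerivAt.mul ((hφ.differentiable (by simp)) x).hasFDerivAt
      refine (h1.hasLineDerivAt e).lineDeriv.trans ?_
      rw [hg.gradient]
      simp [mul_comm]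
    rw [integral_congr_ae hae, integral_add] at hzero
    · linarith
    · have hφ' : Continuous (fderiv ℝ φ) := hφ.continuous_fderiv (by simp)
      obtain ⟨B', hB'⟩ := (hc.fderiv (𝕜 := ℝ)).exists_bound_of_continuous hφ'
      refine Integrable.of_bound (C := B * (B' * ‖e‖)) (hDm.mul
        (hφ'.clm_apply continuous_const).aestronglyMeasurable) ?_
      filter_upwards [hDB] with x hx
      rw [norm_mul]
      exact mul_le_mul hx ((ContinuousLinearMap.le_opNorm _ _).trans
        (mul_le_mul_of_nonneg_right (hB' x) (norm_nonneg _))) (norm_nonneg _)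
        ((norm_nonneg _).trans hx)
    · obtain ⟨B', hB'⟩ := hc.exists_bound_of_continuous hφ.continuous
      refine Integrable.of_bound (C := (∑ i, ‖affineGradient (A i)‖) * ‖e‖ * B')
        ((hGm.inner aestronglyMeasurable_const).mul
        hφ.continuous.aestronglyMeasurable) ?_
      filter_upwards [hGB] with x hx
      rw [norm_mul]
      exact mul_le_mul ((norm_inner_le_norm _ _).trans
        (mul_le_mul_of_nonneg_right hx (norm_nonneg _))) (hB' x) (norm_nonneg _)
        (mul_nonneg ((norm_nonneg _).trans hx) (norm_nonneg _))
  · intro x hx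
    have hx' : x ∉ tsupport φ := fun hx' => hx (hs hx')
    have : (fun t : ℝ => D (x + t • e) * φ (x + t • e)) =ᶠ[nhds 0] fun _ => 0 := by
      have hline : Continuous fun t : ℝ => x + t • e := by fun_prop
      have h0 := hline.tendsto 0
      rw [zero_smul, add_zero] at h0
      filter_upwards [h0.eventually ((isClosed_tsupport φ).isOpen_compl.mem_nhds hx')] with t ht
      rw [image_eq_zero_of_notMem_tsupport ht, mul_zero]
    rw [lineDeriv, this.deriv_eq]
    simp

theorem eLpNorm_two_sq {E : Type*} [NormedAddCommGroup E] (f : Plane → E) (μ : Measure Plane) :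
    eLpNorm f 2 μ ^ 2 = ∫⁻ x, ‖f x‖ₑ ^ 2 ∂μ := by
  have := eLpNorm_nnreal_pow_eq_lintegral (f := f) (μ := μ) (p := 2) two_ne_zero
  simpa using this

theorem IsPiecewiseAffine.h1Norm_sq_le (h : IsPiecewiseAffine Ω P A D) (b : ι → ℝ≥0∞)
    (hb : ∀ i, ∀ x ∈ P i, ‖D x‖ₑ ^ 2 ≤ b i) :
    h1Norm Ω D ^ 2 ≤ ∑ i, (b i + ‖affineGradient (A i)‖ₑ ^ 2) * volume (P i) := by
  have h1 : h1Norm Ω D ≤ (eLpNorm D 2 (volume.restrict Ω) ^ 2 +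
      eLpNorm (gradient D) 2 (volume.restrict Ω) ^ 2) ^ (1 / 2 : ℝ) :=
    iInf₂_le _ h.isWeakGradient
  have h2 : h1Norm Ω D ^ 2 ≤ eLpNorm D 2 (volume.restrict Ω) ^ 2 +
      eLpNorm (gradient D) 2 (volume.restrict Ω) ^ 2 := by
    refine (pow_le_pow_left' h1 2).trans (le_of_eq ?_)
    rw [← ENNReal.rpow_natCast, ← ENNReal.rpow_mul]
    norm_num
  refine h2.trans ?_
  rw [eLpNorm_two_sq, eLpNorm_two_sq, ← lintegral_add_right _
    ((measurable_gradient D).enorm.pow_const 2)]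
  have hsub : volume.restrict Ω ≤ volume.restrict (⋃ i, interior (P i)) := by
    refine Measure.restrict_mono' ?_ le_rfl
    have := (ae_restrict_iff' h.isOpen.measurableSet).1 h.ae_mem_interior
    filter_upwards [this] with x hx hxΩ
    exact mem_iUnion.2 (hx hxΩ)
  refine (lintegral_mono' hsub le_rfl).trans ((lintegral_iUnion_le _ _).trans ?_)
  rw [tsum_fintype]
  refine Finset.sum_le_sum fun i _ => ?_
  refine le_trans ?_ (mul_le_mul_right (measure_mono interior_subset) _)
  rw [← setLIntegral_const]
  refine setLIntegral_mono measurable_const fun x hx => ?_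
  rw [(hasGradientAt_of_eqOn (h.eqOn i) hx).gradient]
  exact add_le_add (hb i x (interior_subset hx)) le_rfl

end PiecewiseAffine

/-! ### Estimates on a triangle -/

theorem affineMap_eq_sum {s : Finset Plane} {x : Plane} {w : Plane → ℝ} (hw : IsWeight s x w)
    (A : Plane →ᵃ[ℝ] ℝ) : A x = ∑ z ∈ s, w z * A z := by
  have hA : ∀ y, A y = A.linear y + A 0 := fun y => by
    have := A.map_vadd 0 y
    simpa using this
  calc A x = ∑ z ∈ s, w z * A.linear z + (∑ z ∈ s, w z) * A 0 := by
        rw [hA x, hw.sum_eq_one, one_mul, ← hw.sum_smul, map_sum]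
        simp
    _ = _ := by
        rw [Finset.sum_mul, ← Finset.sum_add_distrib]
        exact Finset.sum_congr rfl fun z _ => by rw [hA z]; ring

/-- Cauchy–Schwarz together with ∑ w² ≤ ∑ w = 1. -/
theorem affineMap_sq_le {s : Finset Plane} {x : Plane} (hx : x ∈ convexHull ℝ (s : Set Plane))
    (A : Plane →ᵃ[ℝ] ℝ) : A x ^ 2 ≤ ∑ z ∈ s, A z ^ 2 := by
  obtain ⟨w, hw⟩ := mem_convexHull_iff_exists_isWeight.1 hx
  rw [affineMap_eq_sum hw]
  refine (Finset.sum_mul_sq_le_sq_mul_sq s w A).trans ?_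
  refine mul_le_of_le_one_left (Finset.sum_nonneg fun z _ => sq_nonneg _) ?_
  rw [← hw.sum_eq_one]
  refine Finset.sum_le_sum fun z hz => ?_
  have h1 : w z ≤ 1 := by
    rw [← hw.sum_eq_one]
    exact Finset.single_le_sum (fun z _ => hw.nonneg z) hz
  nlinarith [hw.nonneg z]

-- In the coordinates (w_p, w_q) the triangle lies in the unit disc, whose affine image has volume
-- scaled by the determinant. This crude bound replaces the exact area.
open Classical in
theorem volume_triangle_le {p q c : Plane} (h : cross (p - c) (q - c) ≠ 0) :
    volume (convexHull ℝ (({p, q, c} : Finset Plane) : Set Plane)) ≤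
      ENNReal.ofReal |cross (p - c) (q - c)| * volume (Metric.closedBall (0 : Plane) 1) := by
  set f : Plane →ₗ[ℝ] Plane :=
    { toFun := fun x => x 0 • (p - c) + x 1 • (q - c)
      map_add' := fun x y => by simp only [PiLp.add_apply]; module
      map_smul' := fun r x => by
        simp only [PiLp.smul_apply, smul_eq_mul, RingHom.id_apply]; module } with hf
  have hdet : LinearMap.det f = cross (p - c) (q - c) := by
    rw [← LinearMap.det_toMatrix (EuclideanSpace.basisFun (Fin 2) ℝ).toBasis,
      Matrix.det_fin_two]
    simp [LinearMap.toMatrix_apply, hf, cross]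
    ring
  rw [← hdet, ← Measure.addHaar_image_linearMap]
  have hsub : convexHull ℝ (({p, q, c} : Finset Plane) : Set Plane) ⊆
      (fun x => c + x) '' (f '' Metric.closedBall 0 1) := by
    intro x hx
    obtain ⟨w, hw⟩ := mem_convexHull_iff_exists_isWeight.1 hx
    rw [isWeight_triple_iff h] at hw
    obtain ⟨w0, -, w1, rfl⟩ := hw
    refine ⟨_, ⟨!₂[w p, w q], ?_, rfl⟩, ?_⟩
    · rw [mem_closedBall_zero_iff, ← sq_le_one_iff₀ (norm_nonneg _), norm_sq_plane]
      simp only [Matrix.cons_val_zero, Matrix.cons_val_one]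
      nlinarith [w0 p, w0 q, w0 c]
    · obtain hc : w c = 1 - w p - w q := by linarith
      simp only [hf, LinearMap.coe_mk, AddHom.coe_mk, Matrix.cons_val_zero,
        Matrix.cons_val_one, hc]
      module
  refine (measure_mono hsub).trans (le_of_eq ?_)
  rw [image_add_left, measure_preimage_add]

/-- Up to a quarter turn, `cross u v` times g is (g·u) v - (g·v) u, so this is Cauchy–Schwarz. The
defect |(g·u) u + (g·v) v|² is what the hints supply. -/
theorem cross_sq_mul_norm_sq_le (g u v : Plane) : cross u v ^ 2 * ‖g‖ ^ 2 ≤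
    (inner ℝ g u ^ 2 + inner ℝ g v ^ 2) * (‖u‖ ^ 2 + ‖v‖ ^ 2) := by
  simp only [norm_sq_plane, cross, PiLp.inner_apply, Fin.sum_univ_two, RCLike.inner_apply,
    conj_trivial]
  nlinarith [sq_nonneg ((u 0 * g 0 + u 1 * g 1) * u 0 + (v 0 * g 0 + v 1 * g 1) * v 0),
    sq_nonneg ((u 0 * g 0 + u 1 * g 1) * u 1 + (v 0 * g 0 + v 1 * g 1) * v 1)]

/-- The two-dimensional scaling argument: squared gradient times area is scale invariant, and shape
regularity cancels one factor of the cross product. -/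
theorem IsShapeRegular.gradient_estimate {σ : ℝ} {K : MarkedTriangle} (hK : IsShapeRegular σ K)
    (A : Plane →ᵃ[ℝ] ℝ) : ‖affineGradient A‖ₑ ^ 2 * volume (convexHull ℝ (K.1 : Set Plane)) ≤
      ENNReal.ofReal (4 * σ * (∑ z ∈ K.1, A z ^ 2)) *
        volume (Metric.closedBall (0 : Plane) 1) := by
  classical
  obtain ⟨p, q, c, rfl, h, hσ⟩ := hK
  refine (mul_le_mul_right (volume_triangle_le h) _).trans ?_
  rw [← mul_assoc]
  refine mul_le_mul_left ?_ _
  rw [← ofReal_norm, ← ENNReal.ofReal_pow (norm_nonneg _), ← ENNReal.ofReal_mul (by positivity)]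
  apply ENNReal.ofReal_le_ofReal
  have hpos : 0 < |cross (p - c) (q - c)| := abs_pos.2 h
  have h1 := cross_sq_mul_norm_sq_le (affineGradient A) (p - c) (q - c)
  rw [← sub_eq_inner_affineGradient, ← sub_eq_inner_affineGradient,
    ← sq_abs (cross _ _)] at h1
  dsimp only
  rw [sum_triple h]
  have h2 : (A p - A c) ^ 2 + (A q - A c) ^ 2 ≤ 4 * (A p ^ 2 + A q ^ 2 + A c ^ 2) := by
    nlinarith [sq_nonneg (A p + A c), sq_nonneg (A q + A c), sq_nonneg (A p), sq_nonneg (A q)]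
  have h3 : ((A p - A c) ^ 2 + (A q - A c) ^ 2) * (‖p - c‖ ^ 2 + ‖q - c‖ ^ 2) ≤
      4 * (A p ^ 2 + A q ^ 2 + A c ^ 2) * (σ * |cross (p - c) (q - c)|) :=
    mul_le_mul h2 hσ (by positivity) (by positivity)
  refine le_of_mul_le_mul_right ?_ hpos
  linarith

section

variable {Ω : Set Plane} {σ : ℝ} {M : MarkedMesh}

/-- The `H¹`-norm of a continuous, piecewise affine function is controlled by the nodal values. -/
theorem IsMarkedTriangulation.h1Norm_sq_le (hM : IsMarkedTriangulation Ω σ M) (hΩ : IsOpen Ω)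
    (hb : Bornology.IsBounded Ω) {D : Plane → ℝ} (hD : ContinuousOn D (closure Ω))
    (hA : ∀ K ∈ M, IsAffineOn D K.1) :
    h1Norm Ω D ^ 2 ≤ (volume (closure Ω) +
      ENNReal.ofReal (4 * σ) * volume (Metric.closedBall (0 : Plane) 1)) *
        ∑ K ∈ M, ENNReal.ofReal (∑ z ∈ K.1, D z ^ 2) := by
  choose A hA using fun K : M => hA K K.2
  have hP : IsPiecewiseAffine Ω (fun K : M => convexHull ℝ (K.1.1 : Set Plane)) A D :=
    { isOpen := hΩ
      isBounded := hb
      isClosed := fun K => isClosed_convexHull_finset _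
      convex := fun K => convex_convexHull ℝ _
      subset := by
        refine subset_closure.trans ?_
        rw [← hM.iUnion_eq, iUnion_subtype]
      continuousOn := hD
      eqOn := hA }
  have hAD : ∀ K : M, ∑ z ∈ K.1.1, A K z ^ 2 = ∑ z ∈ K.1.1, D z ^ 2 := fun K =>
    Finset.sum_congr rfl fun z hz => by rw [hA K (subset_convexHull ℝ _ hz)]
  refine (hP.h1Norm_sq_le (fun K => ENNReal.ofReal (∑ z ∈ K.1.1, D z ^ 2)) fun K x hx => ?_).trans
    ?_
  · rw [← ofReal_norm, ← ENNReal.ofReal_pow (norm_nonneg _), Real.norm_eq_abs, sq_abs, hA K hx,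
      ← hAD K]
    exact ENNReal.ofReal_le_ofReal (affineMap_sq_le hx _)
  · rw [← Finset.sum_coe_sort M, Finset.mul_sum]
    refine Finset.sum_le_sum fun K _ => ?_
    rw [add_mul, add_mul]
    refine add_le_add ?_ ?_
    · rw [mul_comm]
      refine mul_le_mul_left (measure_mono ?_) _
      rw [← hM.iUnion_eq]
      exact subset_biUnion_of_mem (u := fun K : MarkedTriangle => convexHull ℝ (K.1 : Set Plane))
        K.2
    · refine ((hM.shape K K.2).gradient_estimate (A K)).trans (le_of_eq ?_)
      rw [hAD, ENNReal.ofReal_mul' (Finset.sum_nonneg fun z _ => sq_nonneg _)]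
      ring

end

/-! ### The change of the boundary data in one step of the refinement -/

theorem sum_biUnion_le {α β : Type*} [DecidableEq α] [DecidableEq β] (s : Finset α)
    (t : α → Finset β) (f : β → ℝ≥0∞) : ∑ b ∈ s.biUnion t, f b ≤ ∑ a ∈ s, ∑ b ∈ t a, f b := by
  induction s using Finset.induction_on with
  | empty => simp
  | insert a s ha ih =>
    rw [Finset.biUnion_insert, Finset.sum_insert ha]
    have := Finset.sum_union_inter (s₁ := t a) (s₂ := s.biUnion t) (f := f)
    calc _ ≤ ∑ b ∈ t a, f b + ∑ b ∈ s.biUnion t, f b := this ▸ le_self_add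
      _ ≤ _ := add_le_add le_rfl ih

section

variable {Ω : Set Plane} {σ : ℝ} {M M' : MarkedMesh} {F : Finset (Finset Plane)}
  {g g₀ g₁ : Plane → ℝ}

/-- On a boundary edge, the difference of the interpolants vanishes at the endpoints and is affine
on both halves. -/
theorem IsMarkedTriangulation.interpolant_sub (hM : IsMarkedTriangulation Ω σ M)
    (hΩ : interior (closure Ω) = Ω) (hF : ∀ K ∈ M, ∀ E ∈ F, E ⊆ K.1 → K.2 ∈ F)
    (hM' : ∀ K'', K'' ∈ M' ↔ ∃ K ∈ M, K'' ∈ refineElement F K)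
    (h₀ : IsNodalInterpolant Ω (elements M) g g₀) (h₁ : IsNodalInterpolant Ω (elements M') g g₁)
    {a b : Plane} (hab : a ≠ b) {E : Finset Plane} (hE : ∀ z, z ∈ E ↔ z = a ∨ z = b)
    (hEb : E ∈ boundaryEdges (elements M)) :
    g₁ a - g₀ a = 0 ∧ ∃ A : Plane →ᵃ[ℝ] ℝ,
      EqOn (fun x => g₁ x - g₀ x) A (segment ℝ a ((1 / 2 : ℝ) • (a + b))) := by
  classical
  have ho : IsOpen Ω := hΩ ▸ isOpen_interior
  have hsub := hM.segment_subset_frontier ho hEb hab hE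
  have haΓ : a ∈ frontier Ω := hsub (left_mem_segment ℝ a b)
  have hhalf : segment ℝ a ((1 / 2 : ℝ) • (a + b)) ⊆ segment ℝ a b :=
    (convex_segment a b).segment_subset (left_mem_segment ℝ a b)
      ⟨1 / 2, 1 / 2, by norm_num, by norm_num, by norm_num, by rw [smul_add]⟩
  have hEab : E = {a, b} := by ext z; simp [hE]
  obtain ⟨A₀, hA₀⟩ := h₀.isAffineOn E hEb
  rw [hEab, Finset.coe_pair, convexHull_pair] at hA₀
  obtain ⟨⟨K, hK, hEK, -⟩, -⟩ := mem_boundaryEdges.1 hEb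
  have e₀ : g₀ a = g a :=
    h₀.eq_node a (mem_nodes.2 ⟨K, hK, hEK ((hE a).2 (.inl rfl))⟩) haΓ
  obtain ⟨E', hE'b, haE', hE'⟩ : ∃ E' ∈ boundaryEdges (elements M'), a ∈ E' ∧
      segment ℝ a ((1 / 2 : ℝ) • (a + b)) ⊆ convexHull ℝ (E' : Set Plane) := by
    obtain ⟨s1, s2⟩ := hM.boundaryEdges_step hΩ hF hM' hab hE hEb
    by_cases hEF : E ∈ F
    · obtain ⟨E', hE'b, hE'⟩ := s2 hEF
      refine ⟨E', hE'b, (hE' a).2 (.inl rfl), segment_subset_convexHull ?_ ?_⟩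
      · exact (hE' _).2 (.inl rfl)
      · exact (hE' _).2 (.inr rfl)
    · refine ⟨E, s1 hEF, (hE a).2 (.inl rfl), hhalf.trans (segment_subset_convexHull ?_ ?_)⟩
      · exact (hE _).2 (.inl rfl)
      · exact (hE _).2 (.inr rfl)
  obtain ⟨⟨K', hK', hEK', -⟩, -⟩ := mem_boundaryEdges.1 hE'b
  have e₁ : g₁ a = g a := h₁.eq_node a (mem_nodes.2 ⟨K', hK', hEK' haE'⟩) haΓ
  obtain ⟨A₁, hA₁⟩ := h₁.isAffineOn E' hE'b
  refine ⟨by rw [e₀, e₁, sub_self], A₁ - A₀, fun x hx => ?_⟩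
  simp only [AffineMap.coe_sub, Pi.sub_apply]
  rw [hA₁ (hE' hx), hA₀ (hhalf hx)]

theorem IsMarkedTriangulation.weightedArcDerivNorm_sq (hM : IsMarkedTriangulation Ω σ M)
    (hΩ : interior (closure Ω) = Ω) (hF : ∀ K ∈ M, ∀ E ∈ F, E ⊆ K.1 → K.2 ∈ F)
    (hM' : ∀ K'', K'' ∈ M' ↔ ∃ K ∈ M, K'' ∈ refineElement F K)
    (h₀ : IsNodalInterpolant Ω (elements M) g g₀)
    (h₁ : IsNodalInterpolant Ω (elements M') g g₁) :
    weightedArcDerivNorm (elements M) (fun x => g₁ x - g₀ x) ^ 2 =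
      ∑ E ∈ boundaryEdges (elements M),
        ENNReal.ofReal (4 * (g₁ (edgeMidpoint E) - g₀ (edgeMidpoint E)) ^ 2) := by
  classical
  rw [weightedArcDerivNorm, ← ENNReal.rpow_natCast, ← ENNReal.rpow_mul]
  norm_num only [ENNReal.rpow_one]
  refine Finset.sum_congr rfl fun E hE => ?_
  obtain ⟨⟨-, -, -, hE2⟩, -⟩ := mem_boundaryEdges.1 hE
  obtain ⟨a, b, hab, rfl⟩ := Finset.card_eq_two.1 hE2
  obtain ⟨ha, A₁, hA₁⟩ := hM.interpolant_sub hΩ hF hM' h₀ h₁ hab (fun z => by simp) hE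
  obtain ⟨hb, A₂, hA₂⟩ := hM.interpolant_sub hΩ hF hM' h₀ h₁ hab.symm
    (fun z => by simp [or_comm]) hE
  rw [segment_symm, add_comm b a] at hA₂
  rw [edgeMidpoint_pair hab]
  exact diam_mul_eLpNorm_arcDeriv hab hA₁ hA₂ ha hb

/-- One half of each boundary edge is enough: the difference is affine there, rising from zero to
its value at the midpoint, and the halves are disjoint. -/
theorem IsMarkedTriangulation.sum_le_hHalfNorm_sq (hM : IsMarkedTriangulation Ω σ M)
    (hΩ : interior (closure Ω) = Ω) (hF : ∀ K ∈ M, ∀ E ∈ F, E ⊆ K.1 → K.2 ∈ F)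
    (hM' : ∀ K'', K'' ∈ M' ↔ ∃ K ∈ M, K'' ∈ refineElement F K)
    (h₀ : IsNodalInterpolant Ω (elements M) g g₀)
    (h₁ : IsNodalInterpolant Ω (elements M') g g₁) :
    ∑ E ∈ boundaryEdges (elements M),
        ENNReal.ofReal ((g₁ (edgeMidpoint E) - g₀ (edgeMidpoint E)) ^ 2) ≤
      hHalfNorm (frontier Ω) (fun x => g₁ x - g₀ x) ^ 2 := by
  classical
  have ho : IsOpen Ω := hΩ ▸ isOpen_interior
  have hends : ∀ E ∈ boundaryEdges (elements M), ∃ a b : Plane, a ≠ b ∧ E = {a, b} := by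
    intro E hE
    obtain ⟨⟨-, -, -, hE2⟩, -⟩ := mem_boundaryEdges.1 hE
    exact Finset.card_eq_two.1 hE2
  choose! a b hab hE using hends
  have hE' : ∀ E ∈ boundaryEdges (elements M), ∀ z, z ∈ E ↔ z = a E ∨ z = b E := by
    intro E hEb z
    have := hE E hEb
    constructor
    · intro hz
      rw [this] at hz
      simpa using hz
    · intro hz
      rw [this]
      simpa using hz
  set m : Finset Plane → Plane := fun E => (1 / 2 : ℝ) • (a E + b E) with hm
  have hmid : ∀ E, m E ∈ openSegment ℝ (a E) (b E) := fun E =>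
    ⟨1 / 2, 1 / 2, by norm_num, by norm_num, by norm_num, by rw [hm]; simp only [smul_add]⟩
  have hsub : ∀ E, openSegment ℝ (a E) (m E) ⊆ openSegment ℝ (a E) (b E) := fun E => by
    rintro _ ⟨α, β, hα, hβ, hs, rfl⟩
    refine ⟨α + β / 2, β / 2, by positivity, by positivity, by linarith, ?_⟩
    simp only [hm]
    module
  refine le_trans (Finset.sum_le_sum fun E hEb => ?_) (sum_lintegral_le_hHalfNorm
    (S := fun E => openSegment ℝ (a E) (m E)) (fun E hEb => ?_) (fun E hEb => ?_)
    (fun E hEb E₂ hE₂b hne => ?_) _)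
  · obtain ⟨h0, A, hA⟩ := hM.interpolant_sub hΩ hF hM' h₀ h₁ (hab E hEb) (hE' E hEb) hEb
    have hmE : edgeMidpoint E = m E := by
      conv_lhs => rw [hE E hEb]
      rw [edgeMidpoint_pair (hab E hEb)]
    rw [hmE]
    refine le_lintegral_openSegment (d := fun x => g₁ x - g₀ x) ?_ hA h0
    intro h
    have := hmid E
    rw [← h] at this
    exact hab E hEb (left_mem_openSegment_iff.1 this)
  · exact (hsub E).trans ((openSegment_subset_segment ℝ _ _).trans
      (hM.segment_subset_frontier ho hEb (hab E hEb) (hE' E hEb)))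
  · exact measurableSet_openSegment _ _
  · exact (hM.disjoint_openSegment (Finset.mem_filter.1 hEb).1 (Finset.mem_filter.1 hE₂b).1
      (hab E hEb) (hE' E hEb) (hab E₂ hE₂b) (hE' E₂ hE₂b) hne).mono (hsub E) (hsub E₂)

/-- The constant is 12 = 4 · 3: at most four sons with three vertices each. Each boundary edge is
charged to the only element containing it. -/
theorem IsMarkedTriangulation.sum_nodal_le (hM : IsMarkedTriangulation Ω σ M)
    (hΩ : interior (closure Ω) = Ω)
    (hM' : ∀ K'', K'' ∈ M' ↔ ∃ K ∈ M, K'' ∈ refineElement F K)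
    (h₀ : IsNodalInterpolant Ω (elements M) g g₀) (h₁ : IsNodalInterpolant Ω (elements M') g g₁)
    {D : Plane → ℝ} (hD : ∀ z ∈ nodes (elements M'), z ∉ frontier Ω → D z = 0)
    (hDb : ∀ z ∈ nodes (elements M'), z ∈ frontier Ω → D z = g₁ z - g₀ z) :
    ∑ K'' ∈ M', ENNReal.ofReal (∑ z ∈ K''.1, D z ^ 2) ≤
      12 * ∑ E ∈ boundaryEdges (elements M),
        ENNReal.ofReal ((g₁ (edgeMidpoint E) - g₀ (edgeMidpoint E)) ^ 2) := by
  classical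
  set δ : Finset Plane → ℝ := fun E => (g₁ (edgeMidpoint E) - g₀ (edgeMidpoint E)) ^ 2 with hδ
  have hδ0 : ∀ E, 0 ≤ δ E := fun E => sq_nonneg _
  set B := boundaryEdges (elements M) with hB
  have key : ∀ K ∈ M, ∀ K'' ∈ refineElement F K, ∑ z ∈ K''.1, D z ^ 2 ≤
      3 * ∑ E ∈ B with E ⊆ K.1, δ E := by
    intro K hK K'' hK''
    have hK''M : K'' ∈ M' := (hM' K'').2 ⟨K, hK, hK''⟩
    have hcard := ((hM.shape K hK).refineElement hK'').card_eq
    have hbound : ∀ z ∈ K''.1, D z ^ 2 ≤ ∑ E ∈ B with E ⊆ K.1, δ E := by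
      intro z hz
      have hzn : z ∈ nodes (elements M') := mem_nodes.2 ⟨K'', hK''M, hz⟩
      have hs0 : 0 ≤ ∑ E ∈ B with E ⊆ K.1, δ E := Finset.sum_nonneg fun E _ => hδ0 E
      by_cases hzΓ : z ∈ frontier Ω
      · rcases mem_or_eq_midpoint_of_mem_refineElement (hM.shape K hK) hK'' hz with
          hzK | ⟨E, -, hEK, hE2, rfl⟩
        -- At an old boundary node both interpolants equal `g`.
        · rw [hDb z hzn hzΓ, h₁.eq_node z hzn hzΓ, h₀.eq_node z (mem_nodes.2 ⟨K, hK, hzK⟩) hzΓ]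
          simpa using hs0
        · rw [hDb _ hzn hzΓ]
          have hEb := hM.mem_boundaryEdges_of_midpoint hΩ hK hEK hE2 hzΓ
          exact Finset.single_le_sum (f := δ) (fun E _ => hδ0 E)
            (Finset.mem_filter.2 ⟨hEb, hEK⟩)
      · rw [hD z hzn hzΓ]
        simpa using hs0
    refine (Finset.sum_le_card_nsmul _ _ _ hbound).trans (le_of_eq ?_)
    rw [hcard, nsmul_eq_mul]
    norm_num
  have hM'' : M' = M.biUnion (refineElement F) := by
    ext K''
    rw [hM', Finset.mem_biUnion]
  have hK : ∀ K ∈ M, ∑ K'' ∈ refineElement F K, ENNReal.ofReal (∑ z ∈ K''.1, D z ^ 2) ≤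
      12 * ∑ E ∈ B with E ⊆ K.1, ENNReal.ofReal (δ E) := by
    intro K hK
    refine (Finset.sum_le_card_nsmul _ _ _ fun K'' hK'' =>
      ENNReal.ofReal_le_ofReal (key K hK K'' hK'')).trans ?_
    rw [nsmul_eq_mul, ENNReal.ofReal_mul (by norm_num),
      ENNReal.ofReal_sum_of_nonneg fun E _ => hδ0 E, ← mul_assoc]
    refine mul_le_mul_left ?_ _
    have h4 : ((refineElement F K).card : ℝ≥0∞) ≤ 4 := by
      exact_mod_cast card_refineElement_le (hM.shape K hK)
    refine (mul_le_mul_left h4 _).trans (le_of_eq ?_)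
    rw [ENNReal.ofReal_ofNat]
    norm_num
  calc _ ≤ ∑ K ∈ M, ∑ K'' ∈ refineElement F K, ENNReal.ofReal (∑ z ∈ K''.1, D z ^ 2) := by
        rw [hM'']; exact sum_biUnion_le _ _ _
    _ ≤ ∑ K ∈ M, 12 * ∑ E ∈ B with E ⊆ K.1, ENNReal.ofReal (δ E) := Finset.sum_le_sum hK
    _ = 12 * ∑ E ∈ B, ∑ K ∈ M with E ⊆ K.1, ENNReal.ofReal (δ E) := by
        rw [← Finset.mul_sum]
        congr 1
        simp_rw [Finset.sum_filter]
        exact Finset.sum_comm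
    _ ≤ _ := by
        refine mul_le_mul_right (Finset.sum_le_sum fun E hE => ?_) _
        rw [Finset.sum_const, nsmul_eq_mul]
        refine mul_le_of_le_one_left zero_le ?_
        have : (M.filter fun K => E ⊆ K.1).card ≤ 1 := Finset.card_le_one.2 fun K hK L hL =>
          hM.eq_of_boundaryEdge_subset hE (Finset.mem_filter.1 hK).1 (Finset.mem_filter.1 hL).1
            (Finset.mem_filter.1 hK).2 (Finset.mem_filter.1 hL).2
        exact_mod_cast this

end

theorem IsAffineOn.sub {v w : Plane → ℝ} {t : Finset Plane} (hv : IsAffineOn v t)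
    (hw : IsAffineOn w t) : IsAffineOn (fun x => v x - w x) t := by
  obtain ⟨A, hA⟩ := hv
  obtain ⟨B, hB⟩ := hw
  refine ⟨A - B, fun x hx => ?_⟩
  simp only [AffineMap.coe_sub, Pi.sub_apply]
  rw [hA hx, hB hx]

end AFEM

/-! ### Assembly of the estimates. -/

theorem mainTheorem7 (Ω : Set AFEM.Plane) (hΩ : AFEM.IsPolygonalDomain Ω)
    (T₀ : Finset (Finset AFEM.Plane)) (hT₀ : AFEM.IsTriangulation Ω T₀) :
    ∃ C C' : ℝ≥0, 0 < C ∧ 0 < C' ∧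
      ∀ M : ℕ → AFEM.MarkedMesh, AFEM.IsNVBSequence T₀ M →
      ∀ (l : ℕ) (g g₀ g₁ W W' : AFEM.Plane → ℝ),
        AFEM.IsNodalInterpolant Ω (AFEM.elements (M l)) g g₀ →
        AFEM.IsNodalInterpolant Ω (AFEM.elements (M (l + 1))) g g₁ →
        AFEM.IsP1 Ω (AFEM.elements (M (l + 1))) W →
        (∀ x ∈ frontier Ω, W x = g₁ x) →
        AFEM.IsP1 Ω (AFEM.elements (M (l + 1))) W' →
        (∀ z ∈ AFEM.nodes (AFEM.elements (M (l + 1))), z ∉ frontier Ω → W' z = W z) →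
        (∀ z ∈ AFEM.nodes (AFEM.elements (M (l + 1))), z ∈ frontier Ω → W' z = g₀ z) →
        AFEM.h1Norm Ω (fun x => W x - W' x) ≤
            C * AFEM.weightedArcDerivNorm (AFEM.elements (M l)) (fun x => g₁ x - g₀ x) ∧
          C * AFEM.weightedArcDerivNorm (AFEM.elements (M l)) (fun x => g₁ x - g₀ x) ≤
            C' * AFEM.hHalfNorm (frontier Ω) (fun x => g₁ x - g₀ x) := by
  classical
  obtain ⟨σ, hσ⟩ := AFEM.exists_isMarkedTriangulation hT₀
  set C₀ : ℝ≥0∞ := volume (closure Ω) +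
    ENNReal.ofReal (4 * σ) * volume (Metric.closedBall (0 : AFEM.Plane) 1) with hC₀
  have hC₀fin : C₀ ≠ ⊤ := by
    refine ENNReal.add_ne_top.2 ⟨hΩ.isBounded.closure.measure_lt_top.ne, ?_⟩
    exact ENNReal.mul_ne_top ENNReal.ofReal_ne_top Metric.isBounded_closedBall.measure_lt_top.ne
  -- The squared H¹ norm is at most 12 C₀ S and the squared weighted norm is 4S, hence the factor 3.
  -- The summand 1 makes `C` positive.
  set C : ℝ≥0 := NNReal.sqrt (3 * C₀.toNNReal) + 1 with hC
  have hC3 : 3 * C₀ ≤ (C : ℝ≥0∞) ^ 2 := by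
    rw [← ENNReal.coe_toNNReal hC₀fin]
    have h1 : 3 * C₀.toNNReal ≤ C ^ 2 := by
      rw [← NNReal.sq_sqrt (3 * C₀.toNNReal)]
      exact pow_le_pow_left' le_self_add 2
    exact_mod_cast h1
  refine ⟨C, 2 * C, by positivity, by positivity, ?_⟩
  intro M hM l g g₀ g₁ W W' h₀ h₁ hW hWb hW' hWi hWb'
  have hMl := hσ M hM l
  have hMl' := hσ M hM (l + 1)
  obtain ⟨F, -, hF, hM'⟩ := hM.2 l
  have hstep : ∀ K'', K'' ∈ M (l + 1) ↔ ∃ K ∈ M l, K'' ∈ AFEM.refineElement F K := fun K'' => by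
    rw [hM', Finset.mem_biUnion]
  have hweight := hMl.weightedArcDerivNorm_sq hΩ.interior_closure hF hstep h₀ h₁
  have hhalf := hMl.sum_le_hHalfNorm_sq hΩ.interior_closure hF hstep h₀ h₁
  have h4 : AFEM.weightedArcDerivNorm (AFEM.elements (M l)) (fun x => g₁ x - g₀ x) ^ 2 =
      4 * ∑ E ∈ AFEM.boundaryEdges (AFEM.elements (M l)),
        ENNReal.ofReal ((g₁ (AFEM.edgeMidpoint E) - g₀ (AFEM.edgeMidpoint E)) ^ 2) := by
    rw [hweight, Finset.mul_sum]
    refine Finset.sum_congr rfl fun E _ => ?_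
    rw [ENNReal.ofReal_mul (by norm_num), ENNReal.ofReal_ofNat]
  constructor
  · rw [← ENNReal.pow_le_pow_left_iff two_ne_zero, mul_pow, h4]
    have hnodal := hMl.sum_nodal_le hΩ.interior_closure hstep h₀ h₁ (D := fun x => W x - W' x)
      (fun z hz hzΓ => by rw [hWi z hz hzΓ, sub_self])
      (fun z hz hzΓ => by rw [hWb z hzΓ, hWb' z hz hzΓ])
    have hh1 := hMl'.h1Norm_sq_le hΩ.isOpen hΩ.isBounded (hW.1.sub hW'.1) fun K hK =>
      (hW.2 K.1 (AFEM.mem_elements.2 ⟨K, hK, rfl⟩)).sub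
        (hW'.2 K.1 (AFEM.mem_elements.2 ⟨K, hK, rfl⟩))
    refine hh1.trans ((mul_le_mul_right hnodal _).trans ?_)
    rw [← hC₀, ← mul_assoc, ← mul_assoc]
    refine mul_le_mul_left ?_ _
    calc C₀ * 12 = 3 * C₀ * 4 := by ring
      _ ≤ _ := mul_le_mul_left hC3 _
  -- The factor 2 is the square root of the 4 in `h4`.
  · have h2 : AFEM.weightedArcDerivNorm (AFEM.elements (M l)) (fun x => g₁ x - g₀ x) ≤
        2 * AFEM.hHalfNorm (frontier Ω) (fun x => g₁ x - g₀ x) := by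
      rw [← ENNReal.pow_le_pow_left_iff two_ne_zero, mul_pow, h4]
      refine (mul_le_mul_right hhalf _).trans (le_of_eq ?_)
      norm_num
    refine (mul_le_mul_right h2 _).trans (le_of_eq ?_)
    push_cast
    ring
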